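/- Theorem. On $\mathbb{R}^3$ with coordinates $(x,y,z)$ let $f=x^2+y^2-z^2$ and consider the linear Poisson structure $\pi=x\,\partial_y\wedge\partial_z+y\,\partial_z\wedge\partial_x-z\,\partial_x\wedge\partial_y$. A Casimir function is a smooth function $g$ on $\mathbb{R}^3$ with $\{g,h\}=\pi(dg,dh)=0$ for every smooth $h$. Let $C^{flat}$ be the set of Casimir functions all of whose partial derivatives of all orders (including $0$) vanish at the origin, and let $C^{out}$ be the set of Casimir functions whose support is contained in the closure $\overline{O}$ of $O=\{f>0\}$. Let $\Omega_0^{k}(\mathbb{R}^3)$ be the space of smooth differential $k$-forms on $\mathbb{R}^3$ which are flat at $0$ (all partial derivatives of all coefficients, of all orders including $0$, vanish at $0$), and let $H^k_0(\mathcal F,\nu^*)$, $k\ge 0$, denote the $k$-th cohomology of the complex $(df\wedge\Omega_0^{\bullet}(\mathbb{R}^3),d)$, where $d$ is the exterior derivative and $df\wedge\Omega_0^{k}(\mathbb{R}^3)$, which consists of $(k+1)$-forms, is placed in degree $k\ge 0$. Let $d\theta=\frac{1}{x^2+y^2}(-y\,dx+x\,dy)$ on $\mathbb{R}^3\setminus\{x=y=0\}$.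 Then: - ($k=0$) for every $\chi\in C^{flat}$ the form $\chi\,df$ is a cocycle of degree $0$, and every class in $H^0_0(\mathcal F,\nu^*)$ is represented by $\chi\,df$ for a unique $\chi\in C^{flat}$; - ($k=1$) for every $\eta\in C^{out}$ the form $\eta\,df\wedge d\theta$, extended by $0$ to the axis $\{x=y=0\}$, is a cocycle of degree $1$ (in particular it is smooth and lies in $df\wedge\Omega^1_0(\mathbb{R}^3)$), and every class in $H^1_0(\mathcal F,\nu^*)$ is represented by such a form for a unique $\eta\in C^{out}$; - ($k\ge 2$) $H^k_0(\mathcal F,\nu^*)=0$. -/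

import Mathlib

open scoped ContDiff

noncomputable section

namespace FlatFoliated

/-- The space `ℝ³`, with coordinates `x = p 0`, `y = p 1`, `z = p 2`. -/
abbrev R3 : Type := EuclideanSpace ℝ (Fin 3)

/-- Not necessarily smooth differential `n`-forms on `ℝ³`. -/
abbrev Form (n : ℕ) : Type := R3 → R3 [⋀^Fin n]→L[ℝ] ℝ

/-- The basic Casimir function `f(x, y, z) = x² + y² - z²`. -/
def f (p : R3) : ℝ := p 0 ^ 2 + p 1 ^ 2 - p 2 ^ 2

/-- The differential `df`, as a field of covectors. -/
def df (p : R3) : R3 →L[ℝ] ℝ := fderiv ℝ f p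

/-- The partial derivative of `g` in the direction of the `i`-th coordinate. -/
def pd (i : Fin 3) (g : R3 → ℝ) (p : R3) : ℝ :=
  fderiv ℝ g p (EuclideanSpace.single i (1 : ℝ))

/-- The Poisson bracket `{g, h} = π(dg, dh)` of the linear Poisson structure
`π = x ∂_y ∧ ∂_z + y ∂_z ∧ ∂_x - z ∂_x ∧ ∂_y` on `ℝ³ = sl₂(ℝ)*`. -/
def poissonBracket (g h : R3 → ℝ) (p : R3) : ℝ :=
  p 0 * (pd 1 g p * pd 2 h p - pd 2 g p * pd 1 h p)
    + p 1 * (pd 2 g p * pd 0 h p - pd 0 g p * pd 2 h p)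
    - p 2 * (pd 0 g p * pd 1 h p - pd 1 g p * pd 0 h p)

/-- Casimir functions: smooth functions whose bracket with every smooth function vanishes. -/
def IsCasimir (g : R3 → ℝ) : Prop :=
  ContDiff ℝ ∞ g ∧ ∀ h : R3 → ℝ, ContDiff ℝ ∞ h → ∀ p, poissonBracket g h p = 0

/-- A map on `ℝ³` is flat at the origin if all its derivatives (including the zeroth)
vanish there. It is only applied to smooth maps. -/
def FlatAtZero {F : Type*} [NormedAddCommGroup F] [NormedSpace ℝ F] (g : R3 → F) : Prop :=
  ∀ k : ℕ, iteratedFDeriv ℝ k g 0 = 0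

/-- The Casimir functions that are flat at the origin. -/
def CFlat : Set (R3 → ℝ) := {χ | IsCasimir χ ∧ FlatAtZero χ}

/-- The Casimir functions supported in the closure of `O = {f > 0}`. -/
def COut : Set (R3 → ℝ) := {η | IsCasimir η ∧ tsupport η ⊆ closure {p | 0 < f p}}

/-- The exterior product `φ ∧ β` of a covector with an alternating form,
`(φ ∧ β)(v₀, …, vₙ) = ∑ᵢ (-1)ⁱ φ(vᵢ) β(v₀, …, v̂ᵢ, …, vₙ)`. -/
def wedge {n : ℕ} (φ : R3 →L[ℝ] ℝ) (β : R3 [⋀^Fin n]→L[ℝ] ℝ) : R3 [⋀^Fin (n + 1)]→L[ℝ] ℝ :=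
  ContinuousAlternatingMap.alternatizeUncurryFin (φ.smulRight β)

theorem wedge_apply {n : ℕ} (φ : R3 →L[ℝ] ℝ) (β : R3 [⋀^Fin n]→L[ℝ] ℝ) (v : Fin (n + 1) → R3) :
    wedge φ β v = ∑ i : Fin (n + 1), (-1) ^ (i : ℕ) * (φ (v i) * β (i.removeNth v)) := by
  simp [wedge, ContinuousAlternatingMap.alternatizeUncurryFin_apply]

/-- A covector regarded as an alternating form of degree one. -/
def oneForm (φ : R3 →L[ℝ] ℝ) : R3 [⋀^Fin 1]→L[ℝ] ℝ :=
  ContinuousAlternatingMap.ofSubsingleton ℝ R3 ℝ (0 : Fin 1) φ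

/-- The angular one-form `dθ = (-y dx + x dy) / (x² + y²)`. On the axis `x = y = 0`,
where it is not defined, the formula below gives the value `0`. -/
def dθ (p : R3) : R3 →L[ℝ] ℝ :=
  (p 0 ^ 2 + p 1 ^ 2)⁻¹ • (-(p 1) • EuclideanSpace.proj (𝕜 := ℝ) (0 : Fin 3)
    + p 0 • EuclideanSpace.proj (𝕜 := ℝ) (1 : Fin 3))

instance instAddCommGroupSubmoduleForm {n : ℕ} (S : Submodule ℝ (Form n)) : AddCommGroup S :=
  Submodule.addCommGroup S

/-- The space `Ω₀ⁿ(ℝ³)` of smooth `n`-forms that are flat at the origin. -/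
def flatForms (n : ℕ) : Submodule ℝ (Form n) where
  carrier := {α | ContDiff ℝ ∞ α ∧ FlatAtZero α}
  zero_mem' := ⟨contDiff_const, fun k => by
    change iteratedFDeriv ℝ k (fun _ => 0) 0 = 0
    simp⟩
  add_mem' := by
    rintro a b ⟨ha, ha'⟩ ⟨hb, hb'⟩
    refine ⟨ha.add hb, fun k => ?_⟩
    rw [iteratedFDeriv_add_apply (ha.of_le (by exact_mod_cast le_top)).contDiffAt
      (hb.of_le (by exact_mod_cast le_top)).contDiffAt, ha' k, hb' k, add_zero]
  smul_mem' := by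
    rintro c a ⟨ha, ha'⟩
    refine ⟨ha.const_smul c, fun k => ?_⟩
    rw [iteratedFDeriv_const_smul_apply (ha.of_le (by exact_mod_cast le_top)).contDiffAt, ha' k,
      smul_zero]

/-- Exterior multiplication `β ↦ df ∧ β`, as a linear map on forms. -/
def dfWedge (n : ℕ) : Form n →ₗ[ℝ] Form (n + 1) where
  toFun β p := wedge (df p) (β p)
  map_add' a b := by
    funext p; ext v
    simp [wedge_apply, mul_add, Finset.sum_add_distrib]
  map_smul' c a := by
    funext p; ext v
    simp only [wedge_apply, Pi.smul_apply, ContinuousAlternatingMap.smul_apply, smul_eq_mul,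
      RingHom.id_apply, Finset.mul_sum]
    exact Finset.sum_congr rfl fun i _ => by ring

/-- The `k`-th term `df ∧ Ω₀ᵏ(ℝ³)` of the flat foliated complex; its elements are
forms of degree `k + 1`. -/
def foliatedForms (k : ℕ) : Submodule ℝ (Form (k + 1)) := (flatForms k).map (dfWedge k)

theorem extDeriv_mem_flatForms {n : ℕ} {α : Form n} (h : α ∈ flatForms n) :
    extDeriv α ∈ flatForms (n + 1) := by
  obtain ⟨hs, hf⟩ := h
  have h1 : ContDiff ℝ ∞ (fderiv ℝ α) := hs.fderiv_right (by simp)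
  let L := ContinuousAlternatingMap.alternatizeUncurryFinCLM ℝ R3 ℝ (n := n)
  have e : extDeriv α = L ∘ fderiv ℝ α := rfl
  refine ⟨e ▸ L.contDiff.comp h1, fun k => ?_⟩
  have h2 : iteratedFDeriv ℝ k (fderiv ℝ α) 0 = 0 := by
    have := hf (k + 1)
    rw [← norm_eq_zero, norm_iteratedFDeriv_fderiv, this, norm_zero]
  rw [e, L.iteratedFDeriv_comp_left h1.contDiffAt (by exact_mod_cast le_top), h2]
  ext v
  simp

theorem contDiff_f : ContDiff ℝ ∞ f := by
  unfold f; fun_prop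

theorem two_le_infty : (2 : WithTop ℕ∞) ≤ ∞ := WithTop.coe_le_coe.2 le_top

theorem hasFDerivAt_smulRight {E F : Type*} [NormedAddCommGroup E] [NormedSpace ℝ E]
    [NormedAddCommGroup F] [NormedSpace ℝ F] {φ : E → E →L[ℝ] ℝ} {β : E → F} {p : E}
    (hφ : DifferentiableAt ℝ φ p) (hβ : DifferentiableAt ℝ β p) :
    ∃ D₁ D₂ : E →L[ℝ] E →L[ℝ] F, HasFDerivAt (fun q => (φ q).smulRight (β q)) (D₁ + D₂) p ∧
      (∀ u v, D₁ u v = φ p v • fderiv ℝ β p u) ∧ ∀ u v, D₂ u v = fderiv ℝ φ p u v • β p := by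
  have :=
    (ContinuousLinearMap.smulRightL ℝ E F).hasFDerivAt_of_bilinear hφ.hasFDerivAt hβ.hasFDerivAt
  refine ⟨_, _, this, ?_, ?_⟩ <;> intro u v <;> simp

/-- `d(φ ∧ β) = -φ ∧ dβ` for a closed one-form `φ`. -/
theorem extDeriv_wedge_of_symm {E : Type*} [NormedAddCommGroup E] [NormedSpace ℝ E] {n : ℕ}
    {φ : E → E →L[ℝ] ℝ} {β : E → E [⋀^Fin n]→L[ℝ] ℝ} {p : E}
    (hφ : DifferentiableAt ℝ φ p) (hβ : DifferentiableAt ℝ β p)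
    (hsymm : ∀ u v, fderiv ℝ φ p u v = fderiv ℝ φ p v u) :
    extDeriv (fun q => ContinuousAlternatingMap.alternatizeUncurryFin ((φ q).smulRight (β q))) p =
      -ContinuousAlternatingMap.alternatizeUncurryFin ((φ p).smulRight (extDeriv β p)) := by
  let A := ContinuousAlternatingMap.alternatizeUncurryFinCLM ℝ E ℝ (n := n)
  obtain ⟨D₁, D₂, hd, h₁, h₂⟩ := hasFDerivAt_smulRight hφ hβ
  have hA : HasFDerivAt
      (fun q => ContinuousAlternatingMap.alternatizeUncurryFin ((φ q).smulRight (β q)))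
      (A ∘L (D₁ + D₂)) p :=
    A.hasFDerivAt.comp p hd
  have hs1 : ContinuousAlternatingMap.alternatizeUncurryFin (A ∘L D₂) = 0 :=
    ContinuousAlternatingMap.alternatizeUncurryFin_alternatizeUncurryFinCLM_comp_of_symmetric
      fun u v => by rw [h₂, h₂, hsymm u v]
  have hs2 : ContinuousAlternatingMap.alternatizeUncurryFin
      (A ∘L (D₁ + ((ContinuousLinearMap.smulRightL ℝ E _ (φ p)).comp (fderiv ℝ β p)).flip)) = 0 :=
    ContinuousAlternatingMap.alternatizeUncurryFin_alternatizeUncurryFinCLM_comp_of_symmetric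
      fun u v => by simp [h₁, add_comm]
  have e3 : A ∘L ((ContinuousLinearMap.smulRightL ℝ E _ (φ p)).comp (fderiv ℝ β p)).flip =
      (φ p).smulRight (extDeriv β p) := by
    ext u w
    simp [A, extDeriv, ContinuousAlternatingMap.alternatizeUncurryFin_apply, Finset.mul_sum,
      mul_left_comm]
  rw [ContinuousLinearMap.comp_add, ContinuousAlternatingMap.alternatizeUncurryFin_add, e3] at hs2
  rw [extDeriv, hA.fderiv, ContinuousLinearMap.comp_add,
    ContinuousAlternatingMap.alternatizeUncurryFin_add, hs1, add_zero]
  exact eq_neg_of_add_eq_zero_left hs2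

/-- `d(df ∧ β) = -df ∧ dβ`. -/
theorem extDeriv_dfWedge {n : ℕ} {β : Form n} (hβ : ContDiff ℝ ∞ β) :
    extDeriv (dfWedge n β) = -dfWedge (n + 1) (extDeriv β) := by
  have h1 : ContDiff ℝ ∞ df := contDiff_f.fderiv_right (by simp)
  funext p
  exact extDeriv_wedge_of_symm (h1.differentiable (by simp) p) (hβ.differentiable (by simp) p)
    (contDiff_f.contDiffAt.isSymmSndFDerivAt
      (by rw [minSmoothness_of_isRCLikeNormedField]; exact two_le_infty))

/-- The exterior derivative preserves the flat foliated complex. -/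
theorem extDeriv_mem_foliatedForms {k : ℕ} {α : Form (k + 1)} (h : α ∈ foliatedForms k) :
    extDeriv α ∈ foliatedForms (k + 1) := by
  obtain ⟨β, hβ, rfl⟩ := h
  rw [extDeriv_dfWedge hβ.1]
  exact neg_mem ⟨_, extDeriv_mem_flatForms hβ, rfl⟩

theorem contDiff_dfWedge {n : ℕ} {β : Form n} (hβ : ContDiff ℝ ∞ β) :
    ContDiff ℝ ∞ (dfWedge n β) := by
  have h1 : ContDiff ℝ ∞ df := contDiff_f.fderiv_right (by simp)
  exact (ContinuousAlternatingMap.alternatizeUncurryFinCLM ℝ R3 ℝ (n := n)).contDiff.comp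
    (h1.smulRight hβ)

theorem contDiff_of_mem_foliatedForms {k : ℕ} {α : Form (k + 1)} (h : α ∈ foliatedForms k) :
    ContDiff ℝ ∞ α := by
  obtain ⟨β, hβ, rfl⟩ := h
  exact contDiff_dfWedge hβ.1

/-- The differential of the flat foliated complex: the exterior derivative. -/
def d (k : ℕ) : foliatedForms k →ₗ[ℝ] foliatedForms (k + 1) where
  toFun α := ⟨extDeriv α.1, extDeriv_mem_foliatedForms α.2⟩
  map_add' a b := by
    ext1; funext p
    exact extDeriv_add ((contDiff_of_mem_foliatedForms a.2).differentiable (by simp) p)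
      ((contDiff_of_mem_foliatedForms b.2).differentiable (by simp) p)
  map_smul' c a := by
    ext1; funext p
    exact extDeriv_smul c a.1

theorem d_comp_d (k : ℕ) : d (k + 1) ∘ₗ d k = 0 := by
  ext1 a
  exact Subtype.ext (extDeriv_extDeriv (contDiff_of_mem_foliatedForms a.2)
    (by rw [minSmoothness_of_isRCLikeNormedField]; exact two_le_infty))

/-- The cocycles of degree `k`. -/
def cocycles (k : ℕ) : Submodule ℝ (foliatedForms k) := LinearMap.ker (d k)

/-- The coboundaries of degree `k`; the complex starts in degree `0`. -/
def coboundaries : (k : ℕ) → Submodule ℝ (foliatedForms k)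
  | 0 => ⊥
  | k + 1 => LinearMap.range (d k)

theorem coboundaries_le_cocycles (k : ℕ) : coboundaries k ≤ cocycles k := by
  cases k with
  | zero => exact bot_le
  | succ k =>
    rintro _ ⟨a, rfl⟩
    exact LinearMap.congr_fun (d_comp_d k) a

/-- The flat foliated cohomology, i.e. the cohomology of `(df ∧ Ω₀^•(ℝ³), d)` in degree `k`. -/
abbrev H (k : ℕ) : Type := cocycles k ⧸ (coboundaries k).submoduleOf (cocycles k)

/-- The form `α` is a cocycle of the flat foliated complex and represents the class `c`. -/
def Represents {k : ℕ} (α : Form (k + 1)) (c : H k) : Prop :=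
  ∃ z : cocycles k, (z.1 : Form (k + 1)) = α ∧ Submodule.Quotient.mk z = c

/-- The one-form `χ df`. -/
def rep0 (χ : R3 → ℝ) : Form 1 := fun p => χ p • oneForm (df p)

/-- The two-form `η df ∧ dθ`, extended by `0` to the axis `x = y = 0`. For `η ∈ COut` the
function `η` vanishes on this axis, near each of its points other than the origin. -/
def rep1 (η : R3 → ℝ) : Form 2 := fun p => η p • wedge (df p) (oneForm (dθ p))

end FlatFoliated

end

/-! Multiplication by `df` kills exactly what vanishes on the leaves (the level sets of `f` off the
origin), so `df ∧ β` records the restriction of `β` to the leaves, and the complex is the leafwise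
de Rham complex with flat coefficients. The differential is `df ∧ β ↦ -df ∧ dβ`.

In degree 0, `df ∧ dg = 0` says that `g` is constant along leaves, that is, Casimir; and `χ df`
determines `χ` because `df ≠ 0` off the origin.

In degree 1, the class of a leafwise closed flat `β` is its period around the circles about the
axis. Near the axis the leaves are graphs over the `(x, y)`-plane, and in the coordinates `(x, y,
√(-f))` the Poincaré lemma in planes gives a flat primitive; after subtracting it, `β` vanishes
along the leaves on a conical neighbourhood of the axis. Off the axis the leaves are spanned by two
commuting fields, the rotation `rotGen` and `boost`. The circle mean of `β(rotGen)` is the function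
`η`: it is Casimir because `β` is leafwise closed, and it vanishes for `f < 0` because each sheet
there meets the axis. A primitive along circles removes the oscillating part of `β(rotGen)`. What is
then left of `β(boost)` is rotation invariant and is integrated in `z` at fixed `f`. This is
`exists_leafwise_decomposition`. Uniqueness is `eq_zero_of_leafwise_exact`: the period of an exact
form is zero.

In degree 2, `df ∧ dβ = h dx ∧ dy ∧ dz` has to be solved for every flat `h`, and the same three
devices (integration near the axis, along circles, along `boost`) do so in `exists_leafwiseCurl_eq`.
In degree at least 3 the forms have degree at least 4 and vanish.

The analytic difficulty is the origin: homogeneous cutoffs, `√(-f)`, `‖p‖` and `1 / (x² + y²)` are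
singular there. It is met by a calculus of moderate maps, whose derivatives blow up at most
polynomially: moderate times flat is flat, flat after moderate is flat if the inner map tends to 0
at a power rate, and a flat map off the origin extends smoothly by 0 (`FlatOn.smoothFlat`). -/

namespace FlatFoliated

/-! ### Moderate and flat maps near the origin. -/

section Growth

theorem norm_pos_of_mem {E : Type} [NormedAddCommGroup E] {U : Set E} (h0 : (0 : E) ∉ U)
    {p : E} (hp : p ∈ U) : 0 < ‖p‖ :=
  norm_pos_iff.2 fun h => h0 (h ▸ hp)

variable {E F G H : Type} [NormedAddCommGroup E] [NormedSpace ℝ E]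
  [NormedAddCommGroup F] [NormedSpace ℝ F] [NormedAddCommGroup G] [NormedSpace ℝ G]
  [NormedAddCommGroup H] [NormedSpace ℝ H]

/-- The derivatives of `φ` up to order `n` are `O(‖p‖ ^ a)` on `U`, near the origin. -/
def Growth (U : Set E) (φ : E → F) (n : ℕ) (a : ℤ) : Prop :=
  ∃ C : ℝ, 0 ≤ C ∧ ∀ i ≤ n, ∀ p ∈ U, ‖p‖ ≤ 1 → ‖iteratedFDeriv ℝ i φ p‖ ≤ C * ‖p‖ ^ a

/-- Smooth maps on `U` whose derivatives grow at most polynomially at the origin. -/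
structure ModerateOn (U : Set E) (φ : E → F) : Prop where
  smooth : ∀ p ∈ U, ContDiffAt ℝ ∞ φ p
  growth : ∀ n, ∃ a, Growth U φ n a

/-- Smooth maps on `U` all of whose derivatives decay faster than any power at the origin. -/
structure FlatOn (U : Set E) (φ : E → F) : Prop where
  smooth : ∀ p ∈ U, ContDiffAt ℝ ∞ φ p
  growth : ∀ n a, Growth U φ n a

/-- Smooth maps which are flat at the origin. -/
def SmoothFlat (g : E → F) : Prop := ContDiff ℝ ∞ g ∧ ∀ k : ℕ, iteratedFDeriv ℝ k g 0 = 0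

variable {U : Set E}

theorem zpow_le_zpow_of_le_one {t : ℝ} (h0 : 0 < t) (h1 : t ≤ 1) {a b : ℤ} (hab : b ≤ a) :
    t ^ a ≤ t ^ b := by
  obtain ⟨k, rfl⟩ := Int.le.dest hab
  rw [zpow_add₀ h0.ne', zpow_natCast]
  exact mul_le_of_le_one_right (zpow_nonneg h0.le _) (pow_le_one₀ h0.le h1)

theorem Growth.mono (h0 : (0 : E) ∉ U) {φ : E → F} {n m : ℕ} {a b : ℤ} (h : Growth U φ n a)
    (hm : m ≤ n) (hb : b ≤ a) : Growth U φ m b := by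
  obtain ⟨C, hC, h⟩ := h
  refine ⟨C, hC, fun i hi p hp hp1 => (h i (hi.trans hm) p hp hp1).trans ?_⟩
  exact mul_le_mul_of_nonneg_left (zpow_le_zpow_of_le_one (norm_pos_of_mem h0 hp) hp1 hb) hC

theorem FlatOn.moderateOn {φ : E → F} (h : FlatOn U φ) : ModerateOn U φ :=
  ⟨h.smooth, fun n => ⟨0, h.growth n 0⟩⟩

theorem iteratedFDerivWithin_eq (hU : IsOpen U) {φ : E → F} (n : ℕ) {p : E} (hp : p ∈ U) :
    iteratedFDerivWithin ℝ n φ U p = iteratedFDeriv ℝ n φ p :=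
  iteratedFDerivWithin_of_isOpen n hU hp

theorem contDiffOn_of_contDiffAt {φ : E → F} (h : ∀ p ∈ U, ContDiffAt ℝ ∞ φ p) :
    ContDiffOn ℝ ∞ φ U := fun p hp => (h p hp).contDiffWithinAt

theorem Growth.bilin (hU : IsOpen U) (h0 : (0 : E) ∉ U) (B : F →L[ℝ] G →L[ℝ] H)
    {φ : E → F} {ψ : E → G} (hφs : ∀ p ∈ U, ContDiffAt ℝ ∞ φ p)
    (hψs : ∀ p ∈ U, ContDiffAt ℝ ∞ ψ p) {n : ℕ} {a b : ℤ}
    (hφ : Growth U φ n a) (hψ : Growth U ψ n b) :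
    Growth U (fun p => B (φ p) (ψ p)) n (a + b) := by
  obtain ⟨C, hC, hφ⟩ := hφ
  obtain ⟨D, hD, hψ⟩ := hψ
  refine ⟨‖B‖ * ∑ i ∈ Finset.range (n + 1), ∑ j ∈ Finset.range (n + 1), (i.choose j : ℝ) * C * D,
    by positivity, fun i hi p hp hp1 => ?_⟩
  have hpos := norm_pos_of_mem h0 hp
  have key := B.norm_iteratedFDerivWithin_le_of_bilinear (contDiffOn_of_contDiffAt hφs)
    (contDiffOn_of_contDiffAt hψs) hU.uniqueDiffOn hp (n := i) (by exact_mod_cast le_top)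
  simp only [iteratedFDerivWithin_eq hU _ hp] at key
  refine key.trans ?_
  rw [mul_assoc]
  gcongr
  have : ∑ j ∈ Finset.range (i + 1), (i.choose j : ℝ) * ‖iteratedFDeriv ℝ j φ p‖ *
      ‖iteratedFDeriv ℝ (i - j) ψ p‖ ≤
      (∑ j ∈ Finset.range (n + 1), (i.choose j : ℝ) * C * D) * ‖p‖ ^ (a + b) := by
    rw [Finset.sum_mul]
    calc _ ≤ ∑ j ∈ Finset.range (i + 1), (i.choose j : ℝ) * C * D * ‖p‖ ^ (a + b) := by
          refine Finset.sum_le_sum fun j hj => ?_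
          rw [Finset.mem_range] at hj
          have h1 := hφ j (by omega) p hp hp1
          have h2 := hψ (i - j) (by omega) p hp hp1
          rw [zpow_add₀ hpos.ne']
          calc _ ≤ (i.choose j : ℝ) * (C * ‖p‖ ^ a) * (D * ‖p‖ ^ b) := by gcongr
            _ = _ := by ring
      _ ≤ _ := by
          exact Finset.sum_le_sum_of_subset_of_nonneg (Finset.range_mono (Nat.succ_le_succ hi))
            fun j _ _ => by positivity
  refine this.trans ?_
  refine mul_le_mul_of_nonneg_right ?_ (zpow_nonneg hpos.le _)
  exact Finset.single_le_sum
    (f := fun i : ℕ => ∑ j ∈ Finset.range (n + 1), (i.choose j : ℝ) * C * D)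
    (fun i _ => by positivity) (Finset.mem_range.2 (Nat.lt_succ_of_le hi))

theorem ModerateOn.bilin (hU : IsOpen U) (h0 : (0 : E) ∉ U) (B : F →L[ℝ] G →L[ℝ] H)
    {φ : E → F} {ψ : E → G} (hφ : ModerateOn U φ) (hψ : ModerateOn U ψ) :
    ModerateOn U (fun p => B (φ p) (ψ p)) := by
  refine ⟨fun p hp => ?_, fun n => ?_⟩
  · exact B.isBoundedBilinearMap.contDiff.comp_contDiffAt p ((hφ.smooth p hp).prodMk (hψ.smooth p hp))
  · obtain ⟨a, ha⟩ := hφ.growth n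
    obtain ⟨b, hb⟩ := hψ.growth n
    exact ⟨_, ha.bilin hU h0 B hφ.smooth hψ.smooth hb⟩

/-- A loss of `‖p‖ ^ a` from the moderate factor is absorbed by asking for the exponent `c - a` from
the flat one. -/
theorem ModerateOn.bilin_flatOn (hU : IsOpen U) (h0 : (0 : E) ∉ U) (B : F →L[ℝ] G →L[ℝ] H)
    {φ : E → F} {ψ : E → G} (hφ : ModerateOn U φ) (hψ : FlatOn U ψ) :
    FlatOn U (fun p => B (φ p) (ψ p)) := by
  refine ⟨(hφ.bilin hU h0 B hψ.moderateOn).smooth, fun n c => ?_⟩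
  obtain ⟨a, ha⟩ := hφ.growth n
  have := ha.bilin hU h0 B hφ.smooth hψ.smooth (hψ.growth n (c - a))
  rwa [add_sub_cancel] at this

theorem ModerateOn.smul (hU : IsOpen U) (h0 : (0 : E) ∉ U) {φ : E → ℝ} {ψ : E → G}
    (hφ : ModerateOn U φ) (hψ : ModerateOn U ψ) : ModerateOn U (fun p => φ p • ψ p) :=
  ModerateOn.bilin hU h0 (ContinuousLinearMap.lsmul ℝ ℝ) hφ hψ

theorem ModerateOn.mul (hU : IsOpen U) (h0 : (0 : E) ∉ U) {φ ψ : E → ℝ}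
    (hφ : ModerateOn U φ) (hψ : ModerateOn U ψ) : ModerateOn U (fun p => φ p * ψ p) :=
  hφ.smul hU h0 hψ

theorem ModerateOn.smul_flatOn (hU : IsOpen U) (h0 : (0 : E) ∉ U) {φ : E → ℝ} {ψ : E → G}
    (hφ : ModerateOn U φ) (hψ : FlatOn U ψ) : FlatOn U (fun p => φ p • ψ p) :=
  ModerateOn.bilin_flatOn hU h0 (ContinuousLinearMap.lsmul ℝ ℝ) hφ hψ

theorem Growth.add (h0 : (0 : E) ∉ U) {φ ψ : E → F}
    (hφs : ∀ p ∈ U, ContDiffAt ℝ ∞ φ p) (hψs : ∀ p ∈ U, ContDiffAt ℝ ∞ ψ p) {n : ℕ} {a b : ℤ}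
    (hφ : Growth U φ n a) (hψ : Growth U ψ n b) :
    Growth U (fun p => φ p + ψ p) n (min a b) := by
  obtain ⟨C, hC, hφ⟩ := hφ.mono h0 le_rfl (min_le_left a b)
  obtain ⟨D, hD, hψ⟩ := hψ.mono h0 le_rfl (min_le_right a b)
  refine ⟨C + D, by positivity, fun i hi p hp hp1 => ?_⟩
  have : (fun p => φ p + ψ p) = φ + ψ := rfl
  rw [this, iteratedFDeriv_add_apply ((hφs p hp).of_le (by exact_mod_cast le_top))
    ((hψs p hp).of_le (by exact_mod_cast le_top)), add_mul]
  exact (norm_add_le _ _).trans (add_le_add (hφ i hi p hp hp1) (hψ i hi p hp hp1))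

theorem ModerateOn.add (h0 : (0 : E) ∉ U) {φ ψ : E → F}
    (hφ : ModerateOn U φ) (hψ : ModerateOn U ψ) : ModerateOn U (fun p => φ p + ψ p) := by
  refine ⟨fun p hp => (hφ.smooth p hp).add (hψ.smooth p hp), fun n => ?_⟩
  obtain ⟨a, ha⟩ := hφ.growth n
  obtain ⟨b, hb⟩ := hψ.growth n
  exact ⟨_, ha.add h0 hφ.smooth hψ.smooth hb⟩

theorem ContDiff.moderateOn [FiniteDimensional ℝ E] {φ : E → F} (hφ : ContDiff ℝ ∞ φ) :
    ModerateOn U φ := by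
  have : ProperSpace E := FiniteDimensional.proper ℝ E
  refine ⟨fun p _ => hφ.contDiffAt, fun n => ⟨0, ?_⟩⟩
  have h : ∀ i : ℕ, ∃ C, ∀ p ∈ Metric.closedBall (0 : E) 1, ‖iteratedFDeriv ℝ i φ p‖ ≤ C := fun i =>
    (isCompact_closedBall (0 : E) 1).exists_bound_of_continuousOn
      (hφ.continuous_iteratedFDeriv (by exact_mod_cast le_top)).continuousOn
  choose C hC using h
  have hC0 : ∀ i, 0 ≤ C i := fun i => (norm_nonneg _).trans (hC i 0 (by simp))
  refine ⟨∑ i ∈ Finset.range (n + 1), C i, Finset.sum_nonneg fun i _ => hC0 i,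
    fun i hi p _ hp1 => ?_⟩
  rw [zpow_zero, mul_one]
  refine (hC i p (by simpa using hp1)).trans ?_
  exact Finset.single_le_sum (f := C) (fun i _ => hC0 i) (Finset.mem_range.2 (by omega))

/-- Faà di Bruno: each of the at most `n` inner derivatives costs a factor `‖p‖ ^ a`. The
derivatives of `h` are only needed along the image of `φ`, so `h` may be singular elsewhere, as
powers are at 0. -/
theorem Growth.comp (hU : IsOpen U) (h0 : (0 : E) ∉ U) {T : Set F} (hT : IsOpen T)
    {φ : E → F} {h : F → G} (hφs : ∀ p ∈ U, ContDiffAt ℝ ∞ φ p)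
    (hhs : ∀ q ∈ T, ContDiffAt ℝ ∞ h q) (hUT : Set.MapsTo φ U T) {n : ℕ} {a b : ℤ} (ha : a ≤ 0)
    (hφ : Growth U φ n a) {C : ℝ}
    (hh : ∀ i ≤ n, ∀ p ∈ U, ‖p‖ ≤ 1 → ‖iteratedFDeriv ℝ i h (φ p)‖ ≤ C * ‖p‖ ^ b) :
    Growth U (h ∘ φ) n (b + n * a) := by
  obtain ⟨D, hD, hφ⟩ := hφ
  refine ⟨n.factorial * |C| * (D + 1) ^ n, by positivity, fun i hi p hp hp1 => ?_⟩
  have hpos := norm_pos_of_mem h0 hp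
  have h1 : (1 : ℝ) ≤ ‖p‖ ^ a := by
    simpa using zpow_le_zpow_of_le_one hpos hp1 ha
  -- The composition estimate wants the `j`-th derivative bounded by a `j`-th power. A base that is
  -- at least 1 lies below all its positive powers, hence `a ≤ 0` and `D + 1`.
  have hE1 : 1 ≤ (D + 1) * ‖p‖ ^ a := by nlinarith
  have key := norm_iteratedFDerivWithin_comp_le (n := i) (C := |C| * ‖p‖ ^ b)
    (D := (D + 1) * ‖p‖ ^ a) (contDiffOn_of_contDiffAt hhs)
    (contDiffOn_of_contDiffAt hφs) (by exact_mod_cast le_top) hT.uniqueDiffOn hU.uniqueDiffOn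
    hUT hp
    (fun j hj => by
      rw [iteratedFDerivWithin_eq hT _ (hUT hp)]
      refine (hh j (hj.trans hi) p hp hp1).trans ?_
      gcongr
      exact le_abs_self C)
    (fun j hj1 hj => by
      rw [iteratedFDerivWithin_eq hU _ hp]
      refine (hφ j (hj.trans hi) p hp hp1).trans ?_
      refine le_trans ?_ (le_self_pow₀ hE1 (by omega))
      gcongr
      linarith)
  rw [iteratedFDerivWithin_eq hU _ hp] at key
  refine key.trans ?_
  calc (i.factorial : ℝ) * (|C| * ‖p‖ ^ b) * ((D + 1) * ‖p‖ ^ a) ^ i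
      ≤ n.factorial * (|C| * ‖p‖ ^ b) * ((D + 1) * ‖p‖ ^ a) ^ n := by
        gcongr
    _ = _ := by
        rw [zpow_add₀ hpos.ne', mul_pow, mul_comm (n : ℤ) a, zpow_mul, zpow_natCast]
        ring

theorem ModerateOn.exists_nonpos (h0 : (0 : E) ∉ U) {φ : E → F} (hφ : ModerateOn U φ) (n : ℕ) :
    ∃ a ≤ 0, Growth U φ n a := by
  obtain ⟨a, ha⟩ := hφ.growth n
  exact ⟨min a 0, min_le_right _ _, ha.mono h0 le_rfl (min_le_left _ _)⟩

/-- A bounded inner map stays in a compact ball, where the derivatives of `h` are bounded. This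
serves degree-zero homogeneous cutoffs, which are bounded but have no limit at the origin. -/
theorem ModerateOn.contDiff_comp [FiniteDimensional ℝ F] (hU : IsOpen U) (h0 : (0 : E) ∉ U)
    {φ : E → F} {h : F → G} (hφ : ModerateOn U φ) (hh : ContDiff ℝ ∞ h) {R : ℝ}
    (hR : ∀ p ∈ U, ‖p‖ ≤ 1 → ‖φ p‖ ≤ R) : ModerateOn U (fun p => h (φ p)) := by
  have : ProperSpace F := FiniteDimensional.proper ℝ F
  refine ⟨fun p hp => hh.contDiffAt.comp p (hφ.smooth p hp), fun n => ?_⟩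
  obtain ⟨a, ha, hg⟩ := hφ.exists_nonpos h0 n
  have hb : ∀ i : ℕ, ∃ C, ∀ p ∈ Metric.closedBall (0 : F) R, ‖iteratedFDeriv ℝ i h p‖ ≤ C :=
    fun i => (isCompact_closedBall (0 : F) R).exists_bound_of_continuousOn
      (hh.continuous_iteratedFDeriv (by exact_mod_cast le_top)).continuousOn
  choose C hC using hb
  refine ⟨_, hg.comp hU h0 isOpen_univ hφ.smooth (fun q _ => hh.contDiffAt) (Set.mapsTo_univ _ _)
    (C := ∑ i ∈ Finset.range (n + 1), |C i|) (b := 0) ha fun i hi p hp hp1 => ?_⟩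
  rw [zpow_zero, mul_one]
  refine (hC i _ (by simpa using hR p hp hp1)).trans ((le_abs_self _).trans ?_)
  exact Finset.single_le_sum (f := fun i => |C i|) (fun i _ => abs_nonneg _)
    (Finset.mem_range.2 (by omega))

theorem norm_iteratedFDeriv_rpow (r : ℝ) (i : ℕ) :
    ∃ K, 0 ≤ K ∧ ∀ t : ℝ, 0 < t → ‖iteratedFDeriv ℝ i (fun t : ℝ => t ^ r) t‖ ≤ K * t ^ (r - i) := by
  refine ⟨|(descPochhammer ℝ i).eval r|, abs_nonneg _, fun t ht => ?_⟩
  rw [norm_iteratedFDeriv_eq_norm_iteratedDeriv, iteratedDeriv_eq_iterate,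
    Real.iter_deriv_rpow_const, norm_mul, Real.norm_eq_abs, Real.norm_eq_abs,
    abs_of_pos (Real.rpow_pos_of_pos ht _)]

/-- One bound for exponents of either sign: it turns an upper and a lower polynomial bound on `t`
into a bound on all the powers that occur as derivatives of `t ^ r`. -/
theorem rpow_le_add (t : ℝ) (ht : 0 < t) {s : ℝ} {m : ℕ} (hs : |s| ≤ m) :
    t ^ s ≤ t ^ m + (t ^ m)⁻¹ := by
  have hs := abs_le.1 hs
  have h1 : 0 < t ^ m := by positivity
  rcases le_total 1 t with h | h
  · have : t ^ s ≤ t ^ m := by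
      rw [← Real.rpow_natCast]; exact Real.rpow_le_rpow_of_exponent_le h hs.2
    have := inv_pos.2 h1
    linarith
  · have : t ^ s ≤ (t ^ m)⁻¹ := by
      rw [← Real.rpow_natCast, ← Real.rpow_neg ht.le]
      exact Real.rpow_le_rpow_of_exponent_ge ht h hs.1
    linarith

/-- The lower bound by a power of `‖p‖` keeps `φ` polynomially far from the singularity of `t ^ r`
at 0. This is the source of moderate square roots, norms and reciprocals. -/
theorem ModerateOn.rpow (hU : IsOpen U) (h0 : (0 : E) ∉ U) {φ : E → ℝ} (hφ : ModerateOn U φ)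
    (hpos : ∀ p ∈ U, 0 < φ p) {c : ℝ} (hc : 0 < c) {m : ℕ}
    (hb : ∀ p ∈ U, ‖p‖ ≤ 1 → c * ‖p‖ ^ m ≤ φ p) (r : ℝ) : ModerateOn U (fun p => φ p ^ r) := by
  have hsm : ∀ q ∈ Set.Ioi (0 : ℝ), ContDiffAt ℝ ∞ (fun t : ℝ => t ^ r) q := fun q hq =>
    Real.contDiffAt_rpow_const_of_ne (ne_of_gt hq)
  refine ⟨fun p hp => (hsm _ (hpos p hp)).comp p (hφ.smooth p hp), fun n => ?_⟩
  obtain ⟨a, ha, hg⟩ := hφ.exists_nonpos h0 n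
  have hg' := hg
  obtain ⟨D, hD, hφb⟩ := hg'
  choose K hK0 hK using norm_iteratedFDeriv_rpow r
  obtain ⟨M, hM⟩ := exists_nat_ge (|r| + n)
  let S := ∑ i ∈ Finset.range (n + 1), K i
  have hS : 0 ≤ S := Finset.sum_nonneg fun i _ => hK0 i
  refine ⟨_, hg.comp hU h0 isOpen_Ioi hφ.smooth hsm hpos
    (C := S * ((D ^ M) + (c ^ M)⁻¹)) (b := min (a * M) (-(m * M : ℕ))) ha fun i hi p hp hp1 => ?_⟩
  have hp0 := norm_pos_of_mem h0 hp
  have hφp := hpos p hp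
  refine (hK i _ hφp).trans ?_
  have h1 : φ p ^ (r - i) ≤ φ p ^ M + (φ p ^ M)⁻¹ := by
    refine rpow_le_add _ hφp (le_trans ?_ hM)
    refine (abs_sub _ _).trans ?_
    have : (i : ℝ) ≤ n := by exact_mod_cast hi
    simpa using this
  have h2 : φ p ≤ D * ‖p‖ ^ a := by
    have := hφb 0 (by omega) p hp hp1
    rw [norm_iteratedFDeriv_zero, Real.norm_eq_abs, abs_of_pos hφp] at this
    exact this
  have h3 : φ p ^ M ≤ D ^ M * ‖p‖ ^ (min (a * M) (-(m * M : ℕ)) : ℤ) := by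
    calc φ p ^ M ≤ (D * ‖p‖ ^ a) ^ M := by gcongr
      _ = D ^ M * ‖p‖ ^ (a * M) := by rw [mul_pow, zpow_mul, zpow_natCast]
      _ ≤ _ := by
        exact mul_le_mul_of_nonneg_left
          (zpow_le_zpow_of_le_one hp0 hp1 (min_le_left _ _)) (by positivity)
  have h4 : (φ p ^ M)⁻¹ ≤ (c ^ M)⁻¹ * ‖p‖ ^ (min (a * M) (-(m * M : ℕ)) : ℤ) := by
    calc (φ p ^ M)⁻¹ ≤ ((c * ‖p‖ ^ m) ^ M)⁻¹ := by
          gcongr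
          exact hb p hp hp1
      _ = (c ^ M)⁻¹ * ‖p‖ ^ (-(m * M : ℕ) : ℤ) := by
          rw [mul_pow, mul_inv, zpow_neg, zpow_natCast, pow_mul]
      _ ≤ _ := by
        exact mul_le_mul_of_nonneg_left
          (zpow_le_zpow_of_le_one hp0 hp1 (min_le_right _ _)) (by positivity)
  have h5 : K i ≤ S := Finset.single_le_sum (fun i _ => hK0 i) (Finset.mem_range.2 (by omega))
  calc K i * φ p ^ (r - i) ≤ S * (φ p ^ M + (φ p ^ M)⁻¹) := by gcongr
    _ ≤ S * (D ^ M * ‖p‖ ^ (min (a * M) (-(m * M : ℕ)) : ℤ) +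
        (c ^ M)⁻¹ * ‖p‖ ^ (min (a * M) (-(m * M : ℕ)) : ℤ)) := by gcongr
    _ = _ := by ring

theorem SmoothFlat.fderiv {g : E → F} (hg : SmoothFlat g) : SmoothFlat (fderiv ℝ g) := by
  refine ⟨hg.1.fderiv_right (by simp), fun k => ?_⟩
  rw [← norm_eq_zero, norm_iteratedFDeriv_fderiv, hg.2, norm_zero]

theorem SmoothFlat.apply_zero {g : E → F} (hg : SmoothFlat g) : g 0 = 0 := by
  rw [← norm_eq_zero, ← norm_iteratedFDeriv_zero (𝕜 := ℝ), hg.2, norm_zero]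

/-- By the mean value inequality along rays, a bound on the derivative gains one power of `‖p‖`; the
induction changes the target space, so it quantifies over `F`. -/
theorem SmoothFlat.bound [FiniteDimensional ℝ E] (R : ℝ) (N : ℕ) : ∀ {F : Type}
    [NormedAddCommGroup F] [NormedSpace ℝ F] {g : E → F}, SmoothFlat g →
    ∃ C, 0 ≤ C ∧ ∀ p, ‖p‖ ≤ R → ‖g p‖ ≤ C * ‖p‖ ^ N := by
  have : ProperSpace E := FiniteDimensional.proper ℝ E
  induction N with
  | zero =>
    intro F _ _ g hg
    obtain ⟨C, hC⟩ := (isCompact_closedBall (0 : E) R).exists_bound_of_continuousOn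
      hg.1.continuous.continuousOn
    refine ⟨|C|, abs_nonneg _, fun p hp => ?_⟩
    rw [pow_zero, mul_one]
    exact (hC p (by simpa using hp)).trans (le_abs_self _)
  | succ N ih =>
    intro F _ _ g hg
    obtain ⟨C, hC, h⟩ := ih hg.fderiv
    refine ⟨C, hC, fun p hp => ?_⟩
    have := (convex_closedBall (0 : E) ‖p‖).norm_image_sub_le_of_norm_fderiv_le (𝕜 := ℝ) (f := g)
      (C := C * ‖p‖ ^ N) (x := 0) (y := p) (fun x _ => hg.1.differentiable (by simp) x)
      (fun x hx => by
        have hx : ‖x‖ ≤ ‖p‖ := by simpa using hx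
        refine (h x (hx.trans hp)).trans ?_
        gcongr) (by simp) (by simp)
    rw [hg.apply_zero, sub_zero, sub_zero] at this
    rw [pow_succ, ← mul_assoc]
    exact this

theorem SmoothFlat.iterate_bound [FiniteDimensional ℝ E] (R : ℝ) (N k : ℕ) : ∀ {F : Type}
    [NormedAddCommGroup F] [NormedSpace ℝ F] {g : E → F}, SmoothFlat g →
    ∃ C, 0 ≤ C ∧ ∀ p, ‖p‖ ≤ R → ‖iteratedFDeriv ℝ k g p‖ ≤ C * ‖p‖ ^ N := by
  induction k with
  | zero =>
    intro F _ _ g hg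
    simpa only [norm_iteratedFDeriv_zero] using hg.bound R N
  | succ k ih =>
    intro F _ _ g hg
    simpa only [norm_iteratedFDeriv_fderiv] using ih hg.fderiv

/-- The power `m` allows inner maps that are only Hölder at the origin, such as those containing a
square root. -/
theorem SmoothFlat.comp_flatOn [FiniteDimensional ℝ F] (hU : IsOpen U) (h0 : (0 : E) ∉ U)
    {φ : E → F} {h : F → G} (hh : SmoothFlat h) (hφ : ModerateOn U φ) {K : ℝ} {m : ℕ} (hm : m ≠ 0)
    (hK : ∀ p ∈ U, ‖p‖ ≤ 1 → ‖φ p‖ ^ m ≤ K * ‖p‖) : FlatOn U (fun p => h (φ p)) := by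
  refine ⟨fun p hp => hh.1.contDiffAt.comp p (hφ.smooth p hp), fun n c => ?_⟩
  obtain ⟨a, ha, hg⟩ := hφ.exists_nonpos h0 n
  -- The composition estimate yields the exponent `b + n * a`; taking `b = max 0 (c - n * a)` makes
  -- it at least `c`.
  obtain ⟨N, hN⟩ := Int.le.dest (show c - n * a ≤ max 0 (c - n * a) from le_max_right _ _)
  obtain ⟨b, hb⟩ := Int.eq_ofNat_of_zero_le (le_max_left 0 (c - n * a))
  choose C hC0 hC using fun i => hh.iterate_bound (1 + |K|) (m * b) i
  have := hg.comp hU h0 isOpen_univ hφ.smooth (fun q _ => hh.1.contDiffAt) (Set.mapsTo_univ _ _)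
    (C := (∑ i ∈ Finset.range (n + 1), C i) * |K| ^ b) (b := b) ha (fun i hi p hp hp1 => ?_)
  · refine this.mono h0 le_rfl ?_
    have := le_max_right 0 (c - n * a)
    rw [hb] at this
    have h' : (Int.ofNat b) = (b : ℤ) := rfl
    linarith
  have hp0 := norm_pos_of_mem h0 hp
  have h1 : ‖φ p‖ ^ m ≤ |K| * ‖p‖ := (hK p hp hp1).trans (by gcongr; exact le_abs_self K)
  -- A value of norm above 1 is at most its own `m`-th power, hence at most `|K|`.
  have h2 : ‖φ p‖ ≤ 1 + |K| := by
    by_contra hcon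
    push Not at hcon
    have hk := abs_nonneg K
    have h3 : ‖φ p‖ ≤ ‖φ p‖ ^ m := le_self_pow₀ (by linarith) hm
    nlinarith
  refine (hC i _ h2).trans ?_
  have h5 : C i ≤ ∑ i ∈ Finset.range (n + 1), C i :=
    Finset.single_le_sum (fun i _ => hC0 i) (Finset.mem_range.2 (by omega))
  calc C i * ‖φ p‖ ^ (m * b) ≤ (∑ i ∈ Finset.range (n + 1), C i) * (|K| * ‖p‖) ^ b := by
        rw [pow_mul]
        have := (hC0 i).trans h5
        gcongr
    _ = _ := by rw [mul_pow, zpow_natCast]; ring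

theorem SmoothFlat.flatOn [FiniteDimensional ℝ E] {g : E → F} (hg : SmoothFlat g)
    (hU : IsOpen U) (h0 : (0 : E) ∉ U) : FlatOn U g :=
  hg.comp_flatOn hU h0 (φ := fun p => p) (ContDiff.moderateOn contDiff_id) (K := 1) one_ne_zero
    (fun p _ _ => by simp)

theorem hasFDerivAt_zero_of_bound {g : E → F} (h0 : g 0 = 0) {C : ℝ}
    (hb : ∀ p, ‖p‖ ≤ 1 → ‖g p‖ ≤ C * ‖p‖ ^ 2) :
    HasFDerivAt g (0 : E →L[ℝ] F) 0 := by
  rw [hasFDerivAt_iff_isLittleO_nhds_zero]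
  have h1 : (fun v : E => g (0 + v) - g 0 - (0 : E →L[ℝ] F) v) =O[nhds 0] fun v => ‖v‖ ^ 2 := by
    refine Asymptotics.IsBigO.of_bound C ?_
    filter_upwards [Metric.closedBall_mem_nhds (0 : E) one_pos] with v hv
    simpa [h0] using hb v (by simpa using hv)
  exact h1.trans_isLittleO (Asymptotics.isLittleO_norm_pow_id one_lt_two)

/-- The quadratic bound on `g` gives differentiability at 0 with zero derivative, so `fderiv ℝ g`
again satisfies both hypotheses and the induction runs on the order. -/
theorem contDiff_of_growth (n : ℕ) : ∀ {F : Type} [NormedAddCommGroup F] [NormedSpace ℝ F]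
    {g : E → F}, g 0 = 0 → FlatOn {0}ᶜ g → ContDiff ℝ n g ∧ iteratedFDeriv ℝ n g 0 = 0 := by
  have main : ∀ {F : Type} [NormedAddCommGroup F] [NormedSpace ℝ F] {g : E → F}, g 0 = 0 →
      FlatOn {0}ᶜ g → Differentiable ℝ g ∧ fderiv ℝ g 0 = 0 ∧ FlatOn {0}ᶜ (fderiv ℝ g) := by
    intro F _ _ g h0 hg
    obtain ⟨C, hC, h⟩ := hg.growth 0 2
    have hd := hasFDerivAt_zero_of_bound h0 (C := C) (fun p hp1 => by
      by_cases hp : p = 0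
      · simp [hp, h0]
      · simpa using h 0 le_rfl p hp hp1)
    refine ⟨fun p => ?_, hd.fderiv, fun p hp => (hg.smooth p hp).fderiv_right (by simp), ?_⟩
    · by_cases hp : p = 0
      · exact hp ▸ hd.differentiableAt
      · exact (hg.smooth p hp).differentiableAt (by simp)
    · intro m a
      obtain ⟨C, hC, h⟩ := hg.growth (m + 1) a
      refine ⟨C, hC, fun i hi p hp hp1 => ?_⟩
      rw [norm_iteratedFDeriv_fderiv]
      exact h (i + 1) (by omega) p hp hp1
  induction n with
  | zero =>
    intro F _ _ g h0 hg
    refine ⟨?_, ?_⟩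
    · rw [Nat.cast_zero, contDiff_zero]; exact (main h0 hg).1.continuous
    · rw [← norm_eq_zero, norm_iteratedFDeriv_zero, h0, norm_zero]
  | succ n ih =>
    intro F _ _ g h0 hg
    obtain ⟨h1, h2, h3⟩ := main h0 hg
    obtain ⟨h4, h5⟩ := ih h2 h3
    refine ⟨?_, ?_⟩
    · rw [Nat.cast_succ, contDiff_succ_iff_fderiv]
      exact ⟨h1, by simp, h4⟩
    · rw [← norm_eq_zero, ← norm_iteratedFDeriv_fderiv, h5, norm_zero]

/-- A map which is flat on `U` and vanishes near each point outside `U` is smooth and flat. -/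
theorem FlatOn.smoothFlat {g : E → F} (hg : FlatOn U g) (h0 : g 0 = 0)
    (hz : ∀ p ∉ U, p ≠ 0 → g =ᶠ[nhds p] 0) : SmoothFlat g := by
  have h : FlatOn {0}ᶜ g := by
    refine ⟨fun p hp => ?_, fun n a => ?_⟩
    · by_cases hpU : p ∈ U
      · exact hg.smooth p hpU
      · exact contDiffAt_const.congr_of_eventuallyEq (hz p hpU hp)
    · obtain ⟨C, hC, h⟩ := hg.growth n a
      refine ⟨C, hC, fun i hi p hp hp1 => ?_⟩
      by_cases hpU : p ∈ U
      · exact h i hi p hpU hp1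
      · rw [((hz p hpU hp).iteratedFDeriv ℝ i).eq_of_nhds]
        have : iteratedFDeriv ℝ i (0 : E → F) p = 0 := by
          change iteratedFDeriv ℝ i (fun _ => (0 : F)) p = 0
          simp
        rw [this, norm_zero]
        positivity
  exact ⟨contDiff_infty.2 fun n => (contDiff_of_growth n h0 h).1,
    fun n => (contDiff_of_growth n h0 h).2⟩

end Growth

/-! ### Closure properties of flat maps. -/

section SmoothFlatCalculus

variable {E F G H : Type} [NormedAddCommGroup E] [NormedSpace ℝ E]
  [NormedAddCommGroup F] [NormedSpace ℝ F] [NormedAddCommGroup G] [NormedSpace ℝ G]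
  [NormedAddCommGroup H] [NormedSpace ℝ H]

theorem zero_notMem_compl_zero {E : Type} [Zero E] : (0 : E) ∉ ({0}ᶜ : Set E) := fun h => h rfl

theorem FlatOn.smoothFlat_of_compl_zero {g : E → F} (hg : FlatOn {0}ᶜ g) (h0 : g 0 = 0) :
    SmoothFlat g :=
  hg.smoothFlat h0 fun _ hp hp' => (hp hp').elim

theorem SmoothFlat.differentiable {g : E → F} (hg : SmoothFlat g) : Differentiable ℝ g :=
  hg.1.differentiable (by simp)

theorem SmoothFlat.hasFDerivAt {g : E → F} (hg : SmoothFlat g) (p : E) :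
    HasFDerivAt g (_root_.fderiv ℝ g p) p :=
  (hg.differentiable p).hasFDerivAt

theorem SmoothFlat.add {g h : E → F} (hg : SmoothFlat g) (hh : SmoothFlat h) :
    SmoothFlat (fun p => g p + h p) := by
  refine ⟨hg.1.add hh.1, fun k => ?_⟩
  have : (fun p => g p + h p) = g + h := rfl
  rw [this, iteratedFDeriv_add_apply (hg.1.of_le (by exact_mod_cast le_top)).contDiffAt
    (hh.1.of_le (by exact_mod_cast le_top)).contDiffAt, hg.2, hh.2, add_zero]

theorem SmoothFlat.clm_comp {g : E → F} (hg : SmoothFlat g) (L : F →L[ℝ] G) :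
    SmoothFlat (fun p => L (g p)) := by
  refine ⟨L.contDiff.comp hg.1, fun k => ?_⟩
  have : (fun p => L (g p)) = L ∘ g := rfl
  rw [this, L.iteratedFDeriv_comp_left hg.1.contDiffAt (by exact_mod_cast le_top), hg.2]
  ext v
  simp

theorem SmoothFlat.const_smul {g : E → F} (hg : SmoothFlat g) (c : ℝ) :
    SmoothFlat (fun p => c • g p) :=
  hg.clm_comp (c • ContinuousLinearMap.id ℝ F)

theorem SmoothFlat.neg {g : E → F} (hg : SmoothFlat g) : SmoothFlat (fun p => -g p) :=
  hg.clm_comp (-ContinuousLinearMap.id ℝ F)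

theorem SmoothFlat.sub {g h : E → F} (hg : SmoothFlat g) (hh : SmoothFlat h) :
    SmoothFlat (fun p => g p - h p) := by
  simpa only [sub_eq_add_neg] using hg.add hh.neg

variable [FiniteDimensional ℝ E]

/-- The product of a flat map and a map which is moderate where the flat map is supported. -/
theorem SmoothFlat.moderate_bilin {U : Set E} (hU : IsOpen U) (h0 : (0 : E) ∉ U)
    (B : F →L[ℝ] G →L[ℝ] H) {φ : E → F} {g : E → G} (hφ : ModerateOn U φ) (hg : SmoothFlat g)
    (hz : ∀ p ∉ U, p ≠ 0 → g =ᶠ[nhds p] 0) : SmoothFlat (fun p => B (φ p) (g p)) := by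
  refine (hφ.bilin_flatOn hU h0 B (hg.flatOn hU h0)).smoothFlat (by simp [hg.apply_zero]) ?_
  intro p hp hp0
  filter_upwards [hz p hp hp0] with q hq
  simp [hq]

theorem SmoothFlat.moderate_smul {U : Set E} (hU : IsOpen U) (h0 : (0 : E) ∉ U)
    {φ : E → ℝ} {g : E → G} (hφ : ModerateOn U φ) (hg : SmoothFlat g)
    (hz : ∀ p ∉ U, p ≠ 0 → g =ᶠ[nhds p] 0) : SmoothFlat (fun p => φ p • g p) :=
  hg.moderate_bilin hU h0 (ContinuousLinearMap.lsmul ℝ ℝ) hφ hz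

theorem SmoothFlat.smooth_bilin (B : F →L[ℝ] G →L[ℝ] H) {φ : E → F} {g : E → G}
    (hφ : ContDiff ℝ ∞ φ) (hg : SmoothFlat g) : SmoothFlat (fun p => B (φ p) (g p)) :=
  hg.moderate_bilin isOpen_compl_singleton zero_notMem_compl_zero B (ContDiff.moderateOn hφ)
    fun _ hp hp' => (hp hp').elim

theorem SmoothFlat.smooth_mul {φ g : E → ℝ} (hg : SmoothFlat g) (hφ : ContDiff ℝ ∞ φ) :
    SmoothFlat (fun p => φ p * g p) :=
  hg.smooth_bilin (ContinuousLinearMap.mul ℝ ℝ) hφ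

theorem SmoothFlat.smul_smooth {φ : E → F} {g : E → ℝ} (hg : SmoothFlat g) (hφ : ContDiff ℝ ∞ φ) :
    SmoothFlat (fun p => g p • φ p) :=
  hg.smooth_bilin (ContinuousLinearMap.lsmul ℝ ℝ).flip hφ

theorem SmoothFlat.clm_apply {φ : E → F} {g : E → F →L[ℝ] G} (hg : SmoothFlat g)
    (hφ : ContDiff ℝ ∞ φ) : SmoothFlat (fun p => g p (φ p)) :=
  hg.smooth_bilin (ContinuousLinearMap.apply ℝ G) hφ

theorem exists_norm_le_mul_norm {φ : E → F} (hφ : ContDiff ℝ ∞ φ) (h0 : φ 0 = 0) :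
    ∃ K, ∀ p, ‖p‖ ≤ 1 → ‖φ p‖ ≤ K * ‖p‖ := by
  have : ProperSpace E := FiniteDimensional.proper ℝ E
  obtain ⟨C, hC⟩ := (isCompact_closedBall (0 : E) 1).exists_bound_of_continuousOn
    (hφ.continuous_fderiv (by simp)).continuousOn
  refine ⟨C, fun p hp => ?_⟩
  simpa [h0] using (convex_closedBall (0 : E) 1).norm_image_sub_le_of_norm_fderiv_le (𝕜 := ℝ)
    (f := φ) (x := 0) (y := p) (fun x _ => hφ.differentiable (by simp) x) hC (by simp)
    (by simpa using hp)

theorem SmoothFlat.comp_smooth [FiniteDimensional ℝ F] {h : F → G} (hh : SmoothFlat h) {φ : E → F}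
    (hφ : ContDiff ℝ ∞ φ) (h0 : φ 0 = 0) : SmoothFlat (fun p => h (φ p)) := by
  obtain ⟨K, hK⟩ := exists_norm_le_mul_norm hφ h0
  refine (hh.comp_flatOn isOpen_compl_singleton zero_notMem_compl_zero
    (ContDiff.moderateOn hφ) one_ne_zero (K := K) fun p _ hp => ?_).smoothFlat_of_compl_zero
    (by rw [h0, hh.apply_zero])
  simpa using hK p hp

end SmoothFlatCalculus

/-! ### Integrals of flat maps depending on a parameter. -/

section ParametricIntegral

variable {E : Type} [NormedAddCommGroup E] [NormedSpace ℝ E] [FiniteDimensional ℝ E]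

theorem contDiff_fderiv_param {E : Type} [NormedAddCommGroup E] [NormedSpace ℝ E]
    {F : Type} [NormedAddCommGroup F] [NormedSpace ℝ F]
    {h : ℝ → E → F}
    (hh : ContDiff ℝ ∞ (fun x : ℝ × E => h x.1 x.2)) :
    ContDiff ℝ ∞ (fun x : ℝ × E => fderiv ℝ (h x.1) x.2) := by
  refine ContDiff.fderiv (f := fun (x : ℝ × E) y => h x.1 y) (m := ∞) ?_ contDiff_snd (by simp)
  exact hh.comp ((contDiff_fst.comp contDiff_fst).prodMk contDiff_snd)

theorem hasFDerivAt_param_integral {F : Type} [NormedAddCommGroup F] [NormedSpace ℝ F]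
    {h : ℝ → E → F} (hh : ContDiff ℝ ∞ (fun x : ℝ × E => h x.1 x.2)) (p : E) :
    HasFDerivAt (fun p => ∫ t in (0 : ℝ)..1, h t p) (∫ t in (0 : ℝ)..1, fderiv ℝ (h t) p) p := by
  have : ProperSpace E := FiniteDimensional.proper ℝ E
  have hd := contDiff_fderiv_param hh
  have hc : ∀ q, Continuous fun t => h t q := fun q =>
    hh.continuous.comp (continuous_id.prodMk continuous_const)
  have hc' : ∀ q, Continuous fun t => fderiv ℝ (h t) q := fun q =>
    hd.continuous.comp (continuous_id.prodMk continuous_const)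
  obtain ⟨C, hC⟩ := (isCompact_Icc.prod (isCompact_closedBall p 1)).exists_bound_of_continuousOn
    (s := Set.Icc (0 : ℝ) 1 ×ˢ Metric.closedBall p 1) hd.continuous.continuousOn
  refine intervalIntegral.hasFDerivAt_integral_of_dominated_of_fderiv_le (μ := MeasureTheory.volume)
    (F' := fun q t => fderiv ℝ (h t) q) (bound := fun _ => C)
    (Metric.ball_mem_nhds p one_pos) (Filter.Eventually.of_forall fun q =>
      (hc q).aestronglyMeasurable) ((hc p).intervalIntegrable _ _)
    (hc' p).aestronglyMeasurable ?_ intervalIntegrable_const ?_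
  · refine Filter.Eventually.of_forall fun t ht x hx => ?_
    rw [Set.uIoc_of_le zero_le_one] at ht
    exact hC (t, x) ⟨⟨ht.1.le, ht.2⟩, Metric.ball_subset_closedBall hx⟩
  · refine Filter.Eventually.of_forall fun t _ x _ => ?_
    have : ContDiff ℝ ∞ (h t) := hh.comp (contDiff_const.prodMk contDiff_id)
    exact (this.differentiable (by simp) x).hasFDerivAt

theorem contDiff_param_integral (n : ℕ) : ∀ {F : Type} [NormedAddCommGroup F] [NormedSpace ℝ F]
    {h : ℝ → E → F}, ContDiff ℝ ∞ (fun x : ℝ × E => h x.1 x.2) →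
    ContDiff ℝ n (fun p => ∫ t in (0 : ℝ)..1, h t p) := by
  induction n with
  | zero =>
    intro F _ _ h hh
    rw [Nat.cast_zero, contDiff_zero]
    exact continuous_iff_continuousAt.2 fun p => (hasFDerivAt_param_integral hh p).continuousAt
  | succ n ih =>
    intro F _ _ h hh
    rw [Nat.cast_succ, contDiff_succ_iff_fderiv]
    refine ⟨fun p => (hasFDerivAt_param_integral hh p).differentiableAt, by simp, ?_⟩
    rw [funext fun p => (hasFDerivAt_param_integral hh p).fderiv]
    exact ih (contDiff_fderiv_param hh)

theorem flat_param_integral (n : ℕ) : ∀ {F : Type} [NormedAddCommGroup F] [NormedSpace ℝ F]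
    {h : ℝ → E → F}, ContDiff ℝ ∞ (fun x : ℝ × E => h x.1 x.2) → (∀ t, SmoothFlat (h t)) →
    iteratedFDeriv ℝ n (fun p => ∫ t in (0 : ℝ)..1, h t p) 0 = 0 := by
  induction n with
  | zero =>
    intro F _ _ h hh h0
    rw [← norm_eq_zero, norm_iteratedFDeriv_zero]
    simp [(h0 _).apply_zero]
  | succ n ih =>
    intro F _ _ h hh h0
    rw [← norm_eq_zero, ← norm_iteratedFDeriv_fderiv,
      funext fun p => (hasFDerivAt_param_integral hh p).fderiv,
      ih (contDiff_fderiv_param hh) fun t => (h0 t).fderiv, norm_zero]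

variable {E' F : Type} [NormedAddCommGroup E'] [NormedSpace ℝ E'] [FiniteDimensional ℝ E']
  [NormedAddCommGroup F] [NormedSpace ℝ F] {g : E' → F} {a : ℝ → ℝ} {L : ℝ → E →L[ℝ] E'}

theorem contDiff_smul_comp_clm {E E' F : Type} [NormedAddCommGroup E] [NormedSpace ℝ E]
    [NormedAddCommGroup E'] [NormedSpace ℝ E'] [NormedAddCommGroup F] [NormedSpace ℝ F]
    {g : E' → F} {a : ℝ → ℝ} {L : ℝ → E →L[ℝ] E'}
    (hg : ContDiff ℝ ∞ g) (ha : ContDiff ℝ ∞ a) (hL : ContDiff ℝ ∞ L) :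
    ContDiff ℝ ∞ (fun x : ℝ × E => a x.1 • g (L x.1 x.2)) :=
  (ha.comp contDiff_fst).smul (hg.comp ((hL.comp contDiff_fst).clm_apply contDiff_snd))

/-- Linear maps fix the origin, so each integrand is flat. Scalings `L t` give primitives along
lines; rotations give circle means and circle primitives. -/
theorem SmoothFlat.integral_smul_comp (hg : SmoothFlat g) (ha : ContDiff ℝ ∞ a)
    (hL : ContDiff ℝ ∞ L) : SmoothFlat (fun p => ∫ t in (0 : ℝ)..1, a t • g (L t p)) := by
  have h := contDiff_smul_comp_clm hg.1 ha hL
  refine ⟨contDiff_infty.2 fun n => contDiff_param_integral n h, fun n => flat_param_integral n h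
    fun t => ?_⟩
  exact (hg.comp_smooth (L t).contDiff (map_zero _)).const_smul (a t)

theorem fderiv_integral_smul_comp [CompleteSpace F] (hg : ContDiff ℝ ∞ g) (ha : ContDiff ℝ ∞ a)
    (hL : ContDiff ℝ ∞ L) (p v : E) :
    fderiv ℝ (fun p => ∫ t in (0 : ℝ)..1, a t • g (L t p)) p v =
      ∫ t in (0 : ℝ)..1, a t • fderiv ℝ g (L t p) (L t v) := by
  have h := contDiff_smul_comp_clm hg ha hL
  rw [(hasFDerivAt_param_integral (h := fun t p => a t • g (L t p)) h p).fderiv,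
    ContinuousLinearMap.intervalIntegral_apply]
  · refine intervalIntegral.integral_congr fun t _ => ?_
    have h1 : HasFDerivAt (fun p => g (L t p)) ((fderiv ℝ g (L t p)).comp (L t)) p :=
      (hg.differentiable (by simp) (L t p)).hasFDerivAt.comp p (L t).hasFDerivAt
    have h2 : fderiv ℝ (fun p => a t • g (L t p)) p = _ := (h1.const_smul (a t)).fderiv
    rw [h2]
    rfl
  · exact ((contDiff_fderiv_param (h := fun t p => a t • g (L t p)) h).continuous.comp
      (continuous_id.prodMk continuous_const)).intervalIntegrable _ _

end ParametricIntegral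

/-! ### Primitives along a line. -/

section Primitive

variable {E : Type} [NormedAddCommGroup E] [NormedSpace ℝ E]

/-- The linear map which multiplies the `e`-component (measured by `ℓ`) by `t`. -/
noncomputable def scaleAlong (ℓ : E →L[ℝ] ℝ) (e : E) (t : ℝ) : E →L[ℝ] E :=
  ContinuousLinearMap.id ℝ E + (t - 1) • ℓ.smulRight e

theorem scaleAlong_apply (ℓ : E →L[ℝ] ℝ) (e : E) (t : ℝ) (p : E) :
    scaleAlong ℓ e t p = p + (t - 1) • ℓ p • e := by simp [scaleAlong]

theorem contDiff_scaleAlong (ℓ : E →L[ℝ] ℝ) (e : E) : ContDiff ℝ ∞ (scaleAlong ℓ e) := by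
  unfold scaleAlong; fun_prop

/-- The primitive of `g` along `e` which vanishes on the kernel of `ℓ`. -/
noncomputable def primitiveAlong (ℓ : E →L[ℝ] ℝ) (e : E) (g : E → ℝ) (p : E) : ℝ :=
  ℓ p * ∫ t in (0 : ℝ)..1, (1 : ℝ) • g (scaleAlong ℓ e t p)

variable [FiniteDimensional ℝ E] {ℓ : E →L[ℝ] ℝ} {e : E} {g : E → ℝ}

theorem SmoothFlat.primitiveAlong (hg : SmoothFlat g) : SmoothFlat (primitiveAlong ℓ e g) :=
  (hg.integral_smul_comp contDiff_const (contDiff_scaleAlong ℓ e)).smooth_mul ℓ.contDiff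

theorem fderiv_primitiveAlong (hg : SmoothFlat g) (p v : E) :
    fderiv ℝ (primitiveAlong ℓ e g) p v =
      ℓ p * (∫ t in (0 : ℝ)..1, fderiv ℝ g (scaleAlong ℓ e t p) (scaleAlong ℓ e t v)) +
        ℓ v * ∫ t in (0 : ℝ)..1, g (scaleAlong ℓ e t p) := by
  have h1 := (hg.integral_smul_comp (a := fun _ => (1 : ℝ)) contDiff_const
    (contDiff_scaleAlong ℓ e)).hasFDerivAt p
  have h2 : fderiv ℝ (primitiveAlong ℓ e g) p = _ := (ℓ.hasFDerivAt.mul h1).fderiv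
  rw [h2]
  change ℓ p * fderiv ℝ (fun p => ∫ t in (0 : ℝ)..1, (1 : ℝ) • g (scaleAlong ℓ e t p)) p v +
    (∫ t in (0 : ℝ)..1, (1 : ℝ) • g (scaleAlong ℓ e t p)) * ℓ v = _
  rw [fderiv_integral_smul_comp hg.1 contDiff_const (contDiff_scaleAlong ℓ e)]
  simp only [one_smul]
  ring

theorem fderiv_primitiveAlong_self (hg : SmoothFlat g) (he : ℓ e = 1) (p : E) :
    fderiv ℝ (primitiveAlong ℓ e g) p e = g p := by
  rw [fderiv_primitiveAlong hg, he, one_mul]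
  have hL := (contDiff_scaleAlong ℓ e)
  have hLp : Continuous fun t => scaleAlong ℓ e t p := (hL.clm_apply contDiff_const).continuous
  have hLe : Continuous fun t => scaleAlong ℓ e t e := (hL.clm_apply contDiff_const).continuous
  have hc1 : Continuous fun t => g (scaleAlong ℓ e t p) := hg.1.continuous.comp hLp
  have hc2 : Continuous fun t => fderiv ℝ g (scaleAlong ℓ e t p) (scaleAlong ℓ e t e) :=
    (hg.fderiv.1.continuous.comp hLp).clm_apply hLe
  have hc3 : Continuous fun t =>
      ℓ p * fderiv ℝ g (scaleAlong ℓ e t p) (scaleAlong ℓ e t e) := continuous_const.mul hc2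
  rw [← intervalIntegral.integral_const_mul, ← intervalIntegral.integral_add
    (hc3.intervalIntegrable _ _) (hc1.intervalIntegrable _ _)]
  -- The integrand is the derivative of `t * g (S_t p)`, where `S_t` is the scaling, since `S_t e =
  -- t • e`; this product is 0 at `t = 0` and `g p` at `t = 1`.
  have hd : ∀ t ∈ Set.uIcc (0 : ℝ) 1, HasDerivAt (fun t => t * g (scaleAlong ℓ e t p))
      (ℓ p * fderiv ℝ g (scaleAlong ℓ e t p) (scaleAlong ℓ e t e) + g (scaleAlong ℓ e t p)) t := by
    intro t _
    have h1 : HasDerivAt (fun t => scaleAlong ℓ e t p) (ℓ p • e) t := by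
      simp only [scaleAlong_apply]
      simpa using (((hasDerivAt_id t).sub_const 1).smul_const (ℓ p • e)).const_add p
    have h2 := (hasDerivAt_id t).mul ((hg.hasFDerivAt _).comp_hasDerivAt t h1)
    refine h2.congr_deriv ?_
    have : scaleAlong ℓ e t e = t • e := by
      rw [scaleAlong_apply, he, one_smul, sub_smul, one_smul]; abel
    simp [this]
    ring
  rw [intervalIntegral.integral_eq_sub_of_hasDerivAt hd
    ((hc3.add hc1).intervalIntegrable _ _)]
  simp [scaleAlong_apply]

/-- The scaling fixes vectors in the kernel of `ℓ`. Hence a derivative of `g` that vanishes in such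
a direction stays zero for the primitive, which lets line primitives be taken one variable after
another. -/
theorem fderiv_primitiveAlong_of_apply_eq_zero (hg : SmoothFlat g) (p v : E) (hv : ℓ v = 0) :
    fderiv ℝ (primitiveAlong ℓ e g) p v =
      ℓ p * ∫ t in (0 : ℝ)..1, fderiv ℝ g (scaleAlong ℓ e t p) v := by
  rw [fderiv_primitiveAlong hg, hv, zero_mul, add_zero]
  simp [scaleAlong_apply, hv]

end Primitive

/-! ### Rotations, the tangent fields of the leaves, and integration along them. -/

noncomputable section Geometry

/-- The coordinate vectors of `ℝ³`. -/
abbrev basisVec (i : Fin 3) : R3 := EuclideanSpace.single i (1 : ℝ)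

/-- The coordinate functions of `ℝ³`. -/
abbrev coord (i : Fin 3) : R3 →L[ℝ] ℝ := EuclideanSpace.proj i

/-- The projection to the plane `z = 0`. -/
def horizontal : R3 →L[ℝ] R3 :=
  (coord 0).smulRight (basisVec 0) + (coord 1).smulRight (basisVec 1)

/-- The generator `x ∂_y - y ∂_x` of the rotations around the axis `x = y = 0`. -/
def rotGen : R3 →L[ℝ] R3 :=
  (coord 0).smulRight (basisVec 1) - (coord 1).smulRight (basisVec 0)

/-- The rotation by the angle `t` around the axis `x = y = 0`. -/
def rot (t : ℝ) : R3 →L[ℝ] R3 :=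
  Real.cos t • horizontal + Real.sin t • rotGen + (coord 2).smulRight (basisVec 2)

/-- The vector field `xz ∂_x + yz ∂_y + (x² + y²) ∂_z`, which is tangent to the leaves. -/
def boost (p : R3) : R3 := p 2 • horizontal p + (p 0 ^ 2 + p 1 ^ 2) • basisVec 2

@[simp] theorem basisVec_self (i : Fin 3) : (basisVec i) i = 1 := by simp
@[simp] theorem horizontal_zero (p : R3) : horizontal p 0 = p 0 := by simp [horizontal]
@[simp] theorem horizontal_one (p : R3) : horizontal p 1 = p 1 := by simp [horizontal]
@[simp] theorem horizontal_two (p : R3) : horizontal p 2 = 0 := by simp [horizontal]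
@[simp] theorem rotGen_zero (p : R3) : rotGen p 0 = -p 1 := by simp [rotGen]
@[simp] theorem rotGen_one (p : R3) : rotGen p 1 = p 0 := by simp [rotGen]
@[simp] theorem rotGen_two (p : R3) : rotGen p 2 = 0 := by simp [rotGen]
@[simp] theorem rot_zero_apply (t : ℝ) (p : R3) :
    rot t p 0 = Real.cos t * p 0 - Real.sin t * p 1 := by simp [rot]; ring
@[simp] theorem rot_one_apply (t : ℝ) (p : R3) :
    rot t p 1 = Real.cos t * p 1 + Real.sin t * p 0 := by simp [rot]
@[simp] theorem rot_two_apply (t : ℝ) (p : R3) : rot t p 2 = p 2 := by simp [rot]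
@[simp] theorem boost_zero (p : R3) : boost p 0 = p 0 * p 2 := by simp [boost, mul_comm]
@[simp] theorem boost_one (p : R3) : boost p 1 = p 1 * p 2 := by simp [boost, mul_comm]
@[simp] theorem boost_two (p : R3) : boost p 2 = p 0 ^ 2 + p 1 ^ 2 := by simp [boost]

theorem ext_R3 {p q : R3} (h0 : p 0 = q 0) (h1 : p 1 = q 1) (h2 : p 2 = q 2) : p = q := by
  ext i; fin_cases i <;> assumption

theorem norm_sq_R3 (p : R3) : ‖p‖ ^ 2 = p 0 ^ 2 + p 1 ^ 2 + p 2 ^ 2 := by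
  simp [EuclideanSpace.norm_sq_eq, Fin.sum_univ_three]

theorem hasFDerivAt_coord (i : Fin 3) (p : R3) : HasFDerivAt (fun q : R3 => q i) (coord i) p :=
  (coord i).hasFDerivAt

theorem hasFDerivAt_f (p : R3) : HasFDerivAt f
    ((2 * p 0) • coord 0 + (2 * p 1) • coord 1 - (2 * p 2) • coord 2) p := by
  have h := (((hasFDerivAt_coord 0 p).pow 2).add ((hasFDerivAt_coord 1 p).pow 2)).sub
    ((hasFDerivAt_coord 2 p).pow 2)
  refine h.congr_fderiv ?_
  ext v
  simp

theorem df_apply (p u : R3) : df p u = 2 * (p 0 * u 0 + p 1 * u 1 - p 2 * u 2) := by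
  rw [df, (hasFDerivAt_f p).fderiv]
  simp
  ring

theorem df_rotGen (p : R3) : df p (rotGen p) = 0 := by
  rw [df_apply]; simp; ring

theorem df_boost (p : R3) : df p (boost p) = 0 := by
  rw [df_apply]; simp; ring

theorem exists_df_ne_zero {p : R3} (hp : p ≠ 0) : ∃ u, df p u ≠ 0 := by
  by_contra! h
  refine hp (ext_R3 ?_ ?_ ?_)
  · simpa [df_apply] using h (basisVec 0)
  · simpa [df_apply] using h (basisVec 1)
  · simpa [df_apply] using h (basisVec 2)

/-- Off the axis, the tangent spaces of the leaves are spanned by `rotGen` and `boost`. -/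
theorem eq_of_df_eq_zero {p u : R3} (hp : p 0 ^ 2 + p 1 ^ 2 ≠ 0) (hu : df p u = 0) :
    u = ((p 0 ^ 2 + p 1 ^ 2)⁻¹ * (-p 1 * u 0 + p 0 * u 1)) • rotGen p +
      ((p 0 ^ 2 + p 1 ^ 2)⁻¹ * u 2) • boost p := by
  rw [df_apply] at hu
  have hu' : p 2 * u 2 = p 0 * u 0 + p 1 * u 1 := by linarith
  refine ext_R3 ?_ ?_ ?_
  · simp only [PiLp.add_apply, PiLp.smul_apply, rotGen_zero, boost_zero, smul_eq_mul]
    field_simp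
    linear_combination (-p 0) * hu'
  · simp only [PiLp.add_apply, PiLp.smul_apply, rotGen_one, boost_one, smul_eq_mul]
    field_simp
    linear_combination (-p 1) * hu'
  · simp only [PiLp.add_apply, PiLp.smul_apply, rotGen_two, boost_two, smul_eq_mul]
    field_simp
    ring

/-- A continuous map which vanishes off the axis vanishes. -/
theorem eq_zero_of_off_axis {F : Type*} [TopologicalSpace F] [T2Space F] {φ ψ : R3 → F}
    (hφ : Continuous φ) (hψ : Continuous ψ) (h : ∀ p, p 0 ^ 2 + p 1 ^ 2 ≠ 0 → φ p = ψ p) (p : R3) :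
    φ p = ψ p := by
  by_cases hp : p 0 ^ 2 + p 1 ^ 2 = 0
  · have hp0 : p 0 = 0 := by nlinarith [sq_nonneg (p 0), sq_nonneg (p 1)]
    have hc : Continuous fun t : ℝ => p + t • basisVec 0 := by fun_prop
    have key : Set.EqOn (fun t : ℝ => φ (p + t • basisVec 0)) (fun t => ψ (p + t • basisVec 0))
        {0}ᶜ := by
      intro t ht
      refine h _ ?_
      have ht : t ≠ 0 := ht
      have : 0 < t ^ 2 := by positivity
      simp [hp0]
      positivity
    have := congrFun (Continuous.ext_on (dense_compl_singleton (0 : ℝ)) (hφ.comp hc)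
      (hψ.comp hc) key) 0
    simpa using this
  · exact h p hp

theorem contDiff_boost : ContDiff ℝ ∞ boost := by
  unfold boost; fun_prop

theorem rot_rotGen (t : ℝ) (p : R3) : rot t (rotGen p) = rotGen (rot t p) := by
  refine ext_R3 ?_ ?_ ?_ <;> simp <;> ring

theorem rot_boost (t : ℝ) (p : R3) : rot t (boost p) = boost (rot t p) := by
  refine ext_R3 ?_ ?_ ?_ <;> simp
  · ring
  · ring
  · linear_combination (-(p 0 ^ 2 + p 1 ^ 2)) * Real.sin_sq_add_cos_sq t

theorem contDiff_rot : ContDiff ℝ ∞ rot := by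
  unfold rot; fun_prop

theorem rot_zero (p : R3) : rot 0 p = p := by
  refine ext_R3 ?_ ?_ ?_ <;> simp

theorem rot_two_pi (p : R3) : rot (2 * Real.pi) p = p := by
  refine ext_R3 ?_ ?_ ?_ <;> simp

theorem hasDerivAt_rot (p : R3) (t : ℝ) :
    HasDerivAt (fun t => rot t p) (rotGen (rot t p)) t := by
  have h : HasDerivAt (fun t => Real.cos t • horizontal p + Real.sin t • rotGen p +
      (p 2) • basisVec 2) ((-Real.sin t) • horizontal p + Real.cos t • rotGen p) t :=
    (((Real.hasDerivAt_cos t).smul_const _).add ((Real.hasDerivAt_sin t).smul_const _)).add_const _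
  refine h.congr_deriv (ext_R3 ?_ ?_ ?_) <;> simp <;> ring

theorem sq_add_sq_rot (t : ℝ) (p : R3) :
    rot t p 0 ^ 2 + rot t p 1 ^ 2 = p 0 ^ 2 + p 1 ^ 2 := by
  simp only [rot_zero_apply, rot_one_apply]
  linear_combination (p 0 ^ 2 + p 1 ^ 2) * Real.sin_sq_add_cos_sq t

/-- The infinitesimal form of `rot_boost`; it says that `rotGen` and `boost` commute. -/
theorem fderiv_boost_apply_rotGen (p : R3) : fderiv ℝ boost p (rotGen p) = rotGen (boost p) := by
  have h1 : HasDerivAt (fun t => boost (rot t p)) (rotGen (boost p)) 0 := by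
    simp only [← rot_boost]
    have := hasDerivAt_rot (boost p) 0
    rwa [rot_zero] at this
  have h2 := HasFDerivAt.comp_hasDerivAt (l := boost) (0 : ℝ)
    (contDiff_boost.differentiable (by simp) (rot 0 p)).hasFDerivAt (hasDerivAt_rot p 0)
  rw [rot_zero] at h2
  exact h2.unique h1

/-- An open conical neighbourhood of the axis, without the origin. -/
def axisCone : Set R3 := {p | 81 * (p 0 ^ 2 + p 1 ^ 2) < 19 * p 2 ^ 2}

theorem isOpen_axisCone : IsOpen axisCone :=
  isOpen_lt (by fun_prop) (by fun_prop)

theorem rot_mem_axisCone {t : ℝ} {p : R3} (hp : p ∈ axisCone) : rot t p ∈ axisCone := by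
  change 81 * (rot t p 0 ^ 2 + rot t p 1 ^ 2) < 19 * rot t p 2 ^ 2
  rw [sq_add_sq_rot, rot_two_apply]
  exact hp

/-- The mean of `b` over the circles around the axis. -/
def circleMean (b : R3 → ℝ) (p : R3) : ℝ :=
  ∫ t in (0 : ℝ)..1, (1 : ℝ) • b (rot (2 * Real.pi * t) p)

/-- A primitive of `b - circleMean b` along the circles around the axis. -/
def circlePrimitive (b : R3 → ℝ) (p : R3) : ℝ :=
  ∫ t in (0 : ℝ)..1, (2 * Real.pi * t) • b (rot (2 * Real.pi * t) p)

theorem contDiff_rot_mul : ContDiff ℝ ∞ fun t : ℝ => rot (2 * Real.pi * t) :=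
  contDiff_rot.comp (by fun_prop)

variable {b : R3 → ℝ}

theorem SmoothFlat.circleMean (hb : SmoothFlat b) : SmoothFlat (circleMean b) :=
  hb.integral_smul_comp contDiff_const contDiff_rot_mul

theorem SmoothFlat.circlePrimitive (hb : SmoothFlat b) : SmoothFlat (circlePrimitive b) :=
  hb.integral_smul_comp (by fun_prop) contDiff_rot_mul

theorem hasDerivAt_comp_rot (hb : ContDiff ℝ ∞ b) (p : R3) (t : ℝ) :
    HasDerivAt (fun t => b (rot (2 * Real.pi * t) p))
      (2 * Real.pi * fderiv ℝ b (rot (2 * Real.pi * t) p) (rotGen (rot (2 * Real.pi * t) p))) t := by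
  have h1 := (hasDerivAt_rot p (2 * Real.pi * t)).scomp t ((hasDerivAt_id t).const_mul (2 * Real.pi))
  refine ((hb.differentiable (by simp) _).hasFDerivAt.comp_hasDerivAt t h1).congr_deriv ?_
  simp

theorem continuous_fderiv_comp_rot (hb : ContDiff ℝ ∞ b) (X : R3 → R3) (hX : ContDiff ℝ ∞ X)
    (p : R3) : Continuous fun t =>
      fderiv ℝ b (rot (2 * Real.pi * t) p) (X (rot (2 * Real.pi * t) p)) := by
  have h1 : Continuous fun t : ℝ => rot (2 * Real.pi * t) p :=
    (contDiff_rot_mul.clm_apply contDiff_const).continuous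
  exact ((hb.continuous_fderiv (by simp)).comp h1).clm_apply (hX.continuous.comp h1)

theorem integral_fderiv_rotGen (hb : ContDiff ℝ ∞ b) (p : R3) :
    ∫ t in (0 : ℝ)..1, fderiv ℝ b (rot (2 * Real.pi * t) p) (rotGen (rot (2 * Real.pi * t) p)) =
      0 := by
  have h := intervalIntegral.integral_eq_sub_of_hasDerivAt (a := 0) (b := 1)
    (fun t _ => hasDerivAt_comp_rot hb p t)
    ((continuous_const.mul (continuous_fderiv_comp_rot hb rotGen rotGen.contDiff p)).intervalIntegrable
      _ _)
  rw [intervalIntegral.integral_const_mul] at h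
  simpa [rot_two_pi, rot_zero, Real.pi_ne_zero] using h

theorem fderiv_circleMean (hb : ContDiff ℝ ∞ b) (p v : R3) :
    fderiv ℝ (circleMean b) p v =
      ∫ t in (0 : ℝ)..1, fderiv ℝ b (rot (2 * Real.pi * t) p) (rot (2 * Real.pi * t) v) := by
  refine (fderiv_integral_smul_comp (a := fun _ => 1) hb contDiff_const contDiff_rot_mul p v).trans ?_
  simp only [one_smul]

theorem fderiv_circleMean_rotGen (hb : ContDiff ℝ ∞ b) (p : R3) :
    fderiv ℝ (circleMean b) p (rotGen p) = 0 := by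
  rw [fderiv_circleMean hb]
  simp only [rot_rotGen]
  exact integral_fderiv_rotGen hb p

/-- Integration by parts: up to the mean, the integrand is the derivative of `t * b (rot (2πt) p)`,
whose value at `t = 1` is `b p` because the rotation has come full circle. -/
theorem fderiv_circlePrimitive_rotGen (hb : ContDiff ℝ ∞ b) (p : R3) :
    fderiv ℝ (circlePrimitive b) p (rotGen p) = b p - circleMean b p := by
  have h := fderiv_integral_smul_comp (a := fun t => 2 * Real.pi * t) hb (by fun_prop)
    contDiff_rot_mul p (rotGen p)
  refine h.trans ?_
  simp only [rot_rotGen, smul_eq_mul]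
  have hc := continuous_fderiv_comp_rot hb rotGen rotGen.contDiff p
  have hcb : Continuous fun t : ℝ => b (rot (2 * Real.pi * t) p) :=
    hb.continuous.comp (contDiff_rot_mul.clm_apply contDiff_const).continuous
  have hc' : Continuous fun t : ℝ => 2 * Real.pi * t *
      fderiv ℝ b (rot (2 * Real.pi * t) p) (rotGen (rot (2 * Real.pi * t) p)) := by fun_prop
  have h2 := intervalIntegral.integral_eq_sub_of_hasDerivAt (a := 0) (b := 1)
    (f := fun t => t * b (rot (2 * Real.pi * t) p))
    (f' := fun t => b (rot (2 * Real.pi * t) p) + 2 * Real.pi * t *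
      fderiv ℝ b (rot (2 * Real.pi * t) p) (rotGen (rot (2 * Real.pi * t) p)))
    (fun t _ => ((hasDerivAt_id t).mul (hasDerivAt_comp_rot hb p t)).congr_deriv (by simp; ring))
    ((hcb.add hc').intervalIntegrable _ _)
  rw [intervalIntegral.integral_add (hcb.intervalIntegrable _ _) (hc'.intervalIntegrable _ _)] at h2
  simp only [mul_one, one_mul, zero_mul, sub_zero, rot_two_pi] at h2
  simp only [circleMean, one_smul]
  linarith

theorem circleMean_eq_zero_of_mem_axisCone (hb : ∀ p ∈ axisCone, b p = 0) {p : R3}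
    (hp : p ∈ axisCone) : circleMean b p = 0 := by
  simp [circleMean, hb _ (rot_mem_axisCone hp)]

theorem circlePrimitive_eq_zero_of_mem_axisCone (hb : ∀ p ∈ axisCone, b p = 0) {p : R3}
    (hp : p ∈ axisCone) : circlePrimitive b p = 0 := by
  simp [circlePrimitive, hb _ (rot_mem_axisCone hp)]

theorem comp_rot_eq (hb : ContDiff ℝ ∞ b) (hinv : ∀ p, fderiv ℝ b p (rotGen p) = 0) (t : ℝ)
    (p : R3) : b (rot t p) = b p := by
  have hd : ∀ s, HasDerivAt (fun t => b (rot t p)) 0 s := fun s => by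
    have := (hb.differentiable (by simp) _).hasFDerivAt.comp_hasDerivAt s (hasDerivAt_rot p s)
    rwa [hinv] at this
  have := is_const_of_deriv_eq_zero (fun s => (hd s).differentiableAt) (fun s => (hd s).deriv) t 0
  simpa [rot_zero] using this

/-- The point with cylindrical coordinates `(r, 0, z)`. -/
def meridian (r z : ℝ) : R3 := r • basisVec 0 + z • basisVec 2

/-- The angle is the argument of the complex number `x + iy`. -/
theorem exists_rot_meridian (p : R3) :
    ∃ t, rot t (meridian (Real.sqrt (p 0 ^ 2 + p 1 ^ 2)) (p 2)) = p := by
  let c : ℂ := ⟨p 0, p 1⟩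
  have hc : ‖c‖ = Real.sqrt (p 0 ^ 2 + p 1 ^ 2) := by
    rw [Complex.norm_def, Complex.normSq_apply]
    congr 1
    ring
  have h1 : ‖c‖ * Real.cos c.arg = p 0 := Complex.norm_mul_cos_arg c
  have h2 : ‖c‖ * Real.sin c.arg = p 1 := Complex.norm_mul_sin_arg c
  rw [hc] at h1 h2
  refine ⟨c.arg, ext_R3 ?_ ?_ ?_⟩
  · simpa [meridian, mul_comm] using h1
  · simpa [meridian, mul_comm] using h2
  · simp [meridian]

theorem eq_meridian (hb : ContDiff ℝ ∞ b) (hinv : ∀ p, fderiv ℝ b p (rotGen p) = 0) (p : R3) :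
    b (meridian (Real.sqrt (p 0 ^ 2 + p 1 ^ 2)) (p 2)) = b p := by
  obtain ⟨t, ht⟩ := exists_rot_meridian p
  conv_rhs => rw [← ht]
  rw [comp_rot_eq hb hinv]

/-- A function which vanishes near the axis, in the coordinates `(f, z)` of the half plane
`y = 0 ≤ x`. -/
def inLeafCoords (w : R3 → ℝ) (q : ℝ × ℝ) : ℝ := w (meridian (Real.sqrt (q.1 + q.2 ^ 2)) q.2)

theorem inLeafCoords_eq_zero {w : R3 → ℝ} (h0 : w 0 = 0) (hw : ∀ p ∈ axisCone, w p = 0) {q : ℝ × ℝ}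
    (hq : 81 * (q.1 + q.2 ^ 2) < 19 * q.2 ^ 2) : inLeafCoords w q = 0 := by
  unfold inLeafCoords
  rcases le_total 0 (q.1 + q.2 ^ 2) with h | h
  · refine hw _ ?_
    simpa [axisCone, meridian, Real.sq_sqrt h] using hq
  -- For `f + z² < 0` there is no point with these coordinates. The root then takes the value 0, the
  -- point falls on the axis, and `w` vanishes there: this is an extension by zero.
  · rw [Real.sqrt_eq_zero_of_nonpos h]
    by_cases hz : q.2 = 0
    · rw [hz]
      simpa [meridian] using h0
    · refine hw _ ?_
      simp [axisCone, meridian]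
      positivity

/-- Only the region where `f + z²`, the squared distance to the axis, exceeds `z² / 10` matters;
there the square root is moderate. Elsewhere the function vanishes, with room to spare since `1 / 10
< 19 / 81`. -/
theorem SmoothFlat.inLeafCoords {w : R3 → ℝ} (hw : SmoothFlat w) (hz : ∀ p ∈ axisCone, w p = 0) :
    SmoothFlat (inLeafCoords w) := by
  let U : Set (ℝ × ℝ) := {q | q.2 ^ 2 < 10 * (q.1 + q.2 ^ 2)}
  have hU : IsOpen U := isOpen_lt (by fun_prop) (by fun_prop)
  have h0 : (0 : ℝ × ℝ) ∉ U := by simp [U]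
  have hm : ModerateOn U fun q : ℝ × ℝ => Real.sqrt (q.1 + q.2 ^ 2) := by
    simp only [Real.sqrt_eq_rpow]
    refine ModerateOn.rpow hU h0 (φ := fun q : ℝ × ℝ => q.1 + q.2 ^ 2)
      (ContDiff.moderateOn (by fun_prop)) (c := 1 / 11) (m := 2) ?_ (by norm_num) ?_ _
    · intro q (hq : q.2 ^ 2 < 10 * (q.1 + q.2 ^ 2))
      nlinarith [sq_nonneg q.2]
    · intro q (hq : q.2 ^ 2 < 10 * (q.1 + q.2 ^ 2)) hq1
      have h1 : |q.1| ≤ 11 * (q.1 + q.2 ^ 2) := by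
        rw [abs_le]; constructor <;> nlinarith [sq_nonneg q.2]
      rcases max_choice ‖q.1‖ ‖q.2‖ with h | h
      · have h2 : ‖q‖ = |q.1| := h
        rw [h2] at hq1 ⊢
        nlinarith [abs_nonneg q.1]
      · have h2 : ‖q‖ = |q.2| := h
        rw [h2, sq_abs]
        linarith [sq_nonneg q.2]
  have hΦ : ModerateOn U fun q : ℝ × ℝ => meridian (Real.sqrt (q.1 + q.2 ^ 2)) q.2 := by
    refine ModerateOn.add h0 (hm.smul hU h0 (ContDiff.moderateOn contDiff_const)) ?_
    exact ContDiff.moderateOn (by fun_prop)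
  -- The squared norm of the meridian point is `f + 2z²`, linear in `f`; hence the power 2, and `K =
  -- 3` for `‖q‖ ≤ 1`.
  refine (hw.comp_flatOn hU h0 hΦ two_ne_zero (K := 3) ?_).smoothFlat ?_ ?_
  · intro q (hq : q.2 ^ 2 < 10 * (q.1 + q.2 ^ 2)) hq1
    rw [norm_sq_R3]
    have h1 : |q.1| ≤ ‖q‖ := norm_fst_le q
    have h2 : |q.2| ≤ ‖q‖ := norm_snd_le q
    have h3 : q.1 ≤ |q.1| := le_abs_self _
    have h4 : q.2 ^ 2 ≤ |q.2| := by
      rw [← sq_abs]; nlinarith [abs_nonneg q.2]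
    simp [meridian, Real.sq_sqrt (show 0 ≤ q.1 + q.2 ^ 2 by nlinarith [sq_nonneg q.2])]
    linarith
  · simpa [meridian] using hw.apply_zero
  · intro q hq hq0
    have hq : 10 * (q.1 + q.2 ^ 2) ≤ q.2 ^ 2 := not_lt.1 hq
    have hq' : 81 * (q.1 + q.2 ^ 2) < 19 * q.2 ^ 2 := by
      by_cases h : q.2 = 0
      · have : q.1 ≠ 0 := fun h' => hq0 (Prod.ext h' h)
        rw [h] at hq ⊢
        have : q.1 < 0 := lt_of_le_of_ne (by linarith) this
        linarith
      · have : 0 < q.2 ^ 2 := by positivity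
        linarith
    have hopen : IsOpen {q : ℝ × ℝ | 81 * (q.1 + q.2 ^ 2) < 19 * q.2 ^ 2} :=
      isOpen_lt (by fun_prop) (by fun_prop)
    filter_upwards [hopen.mem_nhds hq'] with q' hq'
    exact inLeafCoords_eq_zero hw.apply_zero hz hq'

/-- An invariant flat function vanishing near the axis has an invariant flat primitive along the
leaves. -/
theorem exists_boost_primitive {w : R3 → ℝ} (hw : SmoothFlat w) (hz : ∀ p ∈ axisCone, w p = 0)
    (hinv : ∀ p, fderiv ℝ w p (rotGen p) = 0) :
    ∃ G : R3 → ℝ, SmoothFlat G ∧ (∀ p ∈ axisCone, G p = 0) ∧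
      (∀ p, fderiv ℝ G p (rotGen p) = 0) ∧
      ∀ p, fderiv ℝ G p (boost p) = (p 0 ^ 2 + p 1 ^ 2) * w p := by
  let ℓ : ℝ × ℝ →L[ℝ] ℝ := ContinuousLinearMap.snd ℝ ℝ ℝ
  have hH := hw.inLeafCoords hz
  have hQ := hH.primitiveAlong (ℓ := ℓ) (e := (0, 1))
  have hφ : ContDiff ℝ ∞ fun p : R3 => (f p, p 2) := contDiff_f.prodMk (by fun_prop)
  have hφd : ∀ p : R3, HasFDerivAt (fun p : R3 => (f p, p 2)) ((df p).prod (coord 2)) p := fun p =>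
    (contDiff_f.differentiable (by simp) p).hasFDerivAt.prodMk (hasFDerivAt_coord 2 p)
  have hd : ∀ p v : R3, fderiv ℝ (fun p => primitiveAlong ℓ (0, 1) (inLeafCoords w) (f p, p 2)) p v =
      fderiv ℝ (primitiveAlong ℓ (0, 1) (inLeafCoords w)) (f p, p 2) (df p v, v 2) := by
    intro p v
    have := HasFDerivAt.comp p (hQ.hasFDerivAt (f p, p 2)) (hφd p)
    rw [show (fun p : R3 => primitiveAlong ℓ (0, 1) (inLeafCoords w) (f p, p 2)) =
      primitiveAlong ℓ (0, 1) (inLeafCoords w) ∘ fun p : R3 => (f p, p 2) from rfl, this.fderiv]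
    rfl
  -- Along `boost` the function `f` is constant and `z` grows at rate `x² + y²`, so integrating `w`
  -- in `z` from `z = 0` at fixed `f` gives the required derivative. For `f < 0` the path starts
  -- outside the image of space, where the integrand is zero by extension.
  refine ⟨fun p => primitiveAlong ℓ (0, 1) (inLeafCoords w) (f p, p 2),
    hQ.comp_smooth hφ (by simp [f]), ?_, ?_, ?_⟩
  · intro p hp
    have hp : 81 * (p 0 ^ 2 + p 1 ^ 2) < 19 * p 2 ^ 2 := hp
    change ℓ (f p, p 2) *
      ∫ t in (0 : ℝ)..1, (1 : ℝ) • inLeafCoords w (scaleAlong ℓ (0, 1) t (f p, p 2)) = 0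
    rw [intervalIntegral.integral_congr (g := fun _ => (0 : ℝ)), intervalIntegral.integral_zero,
      mul_zero]
    intro t ht
    rw [Set.uIcc_of_le zero_le_one] at ht
    have : inLeafCoords w (f p, t * p 2) = 0 := by
      -- Replacing `z` by `t * z` at fixed `f` stays in the zero region, so the primitive still
      -- vanishes near the axis.
      refine inLeafCoords_eq_zero hw.apply_zero hz ?_
      simp only [f]
      have : t ^ 2 ≤ 1 := by nlinarith [ht.1, ht.2]
      nlinarith [mul_le_mul_of_nonneg_right this (sq_nonneg (p 2))]
    simp only [one_smul]
    refine Eq.trans ?_ this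
    rw [scaleAlong_apply]
    congr 1
    ext
    · simp
    · simp [ℓ]; ring
  · intro p
    rw [hd, df_rotGen, rotGen_two]
    exact map_zero _
  · intro p
    rw [hd, df_boost, boost_two]
    have : ((0 : ℝ), p 0 ^ 2 + p 1 ^ 2) = (p 0 ^ 2 + p 1 ^ 2) • ((0 : ℝ), (1 : ℝ)) := by simp
    rw [this, map_smul, fderiv_primitiveAlong_self hH (by simp [ℓ]), smul_eq_mul]
    congr 1
    rw [← eq_meridian hw.1 hinv p, inLeafCoords]
    simp [f]

end Geometry

/-! ### Straightening the leaves near the axis. -/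

noncomputable section Caps

theorem ModerateOn.fderiv {E F : Type} [NormedAddCommGroup E] [NormedSpace ℝ E]
    [NormedAddCommGroup F] [NormedSpace ℝ F] {U : Set E} {φ : E → F} (hφ : ModerateOn U φ) :
    ModerateOn U (fderiv ℝ φ) := by
  refine ⟨fun p hp => (hφ.smooth p hp).fderiv_right (by simp), fun n => ?_⟩
  obtain ⟨a, C, hC, h⟩ := hφ.growth (n + 1)
  refine ⟨a, C, hC, fun i hi p hp hp1 => ?_⟩
  rw [norm_iteratedFDeriv_fderiv]
  exact h (i + 1) (by omega) p hp hp1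

theorem moderateOn_norm_rpow {U : Set R3} (hU : IsOpen U) (h0 : (0 : R3) ∉ U) (r : ℝ) :
    ModerateOn U fun p => (‖p‖ ^ 2) ^ r :=
  ModerateOn.rpow hU h0 (ContDiff.moderateOn (contDiff_norm_sq ℝ))
    (fun p hp => by have := norm_pos_of_mem h0 hp; positivity) one_pos (m := 2)
    (fun p _ _ => by rw [one_mul]) r

theorem moderateOn_norm {U : Set R3} (hU : IsOpen U) (h0 : (0 : R3) ∉ U) :
    ModerateOn U fun p => ‖p‖ := by
  simpa only [← Real.sqrt_eq_rpow, Real.sqrt_sq (norm_nonneg _)] using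
    moderateOn_norm_rpow hU h0 (1 / 2)

theorem moderateOn_norm_inv {U : Set R3} (hU : IsOpen U) (h0 : (0 : R3) ∉ U) :
    ModerateOn U fun p => ‖p‖⁻¹ := by
  have h := moderateOn_norm_rpow hU h0 (-(1 / 2))
  simpa only [Real.rpow_neg (sq_nonneg _), ← Real.sqrt_eq_rpow, Real.sqrt_sq (norm_nonneg _)] using h

/-- The parametrization of the cone `σ z > √(x² + y²)` by `(x, y, √(-f))`. -/
def lift (σ : ℝ) (q : R3) : R3 := horizontal q + (σ * ‖q‖) • basisVec 2

/-- The coordinates `(x, y, √(-f))`. -/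
def drop (p : R3) : R3 := horizontal p + Real.sqrt (-f p) • basisVec 2

/-- A conical neighbourhood of the half axis `σ z > 0`. -/
def cap (σ : ℝ) : Set R3 := {p | 9 / 10 * ‖p‖ < σ * p 2}

/-- A homogeneous bump function, equal to `1` on `cap σ`. -/
def capBump (σ : ℝ) (p : R3) : ℝ := Real.smoothTransition (10 * (σ * p 2 * ‖p‖⁻¹) - 8)

variable {σ : ℝ}

theorem isOpen_cap : IsOpen (cap σ) := isOpen_lt (by fun_prop) (by fun_prop)

theorem capBump_eq_one {p : R3} (hp : p ∈ cap σ) : capBump σ p = 1 := by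
  refine Real.smoothTransition.one_of_one_le ?_
  have hp : 9 / 10 * ‖p‖ < σ * p 2 := hp
  have hp0 : p ≠ 0 := by rintro rfl; simp at hp
  have h : 0 < ‖p‖ := norm_pos_iff.2 hp0
  have : 9 / 10 ≤ σ * p 2 * ‖p‖⁻¹ := by
    rw [← div_eq_mul_inv, le_div_iff₀ h]; exact hp.le
  linarith

theorem capBump_eq_zero {p : R3} (hp : σ * p 2 ≤ 4 / 5 * ‖p‖) : capBump σ p = 0 := by
  refine Real.smoothTransition.zero_of_nonpos ?_
  by_cases hp0 : p = 0
  · simp [hp0]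
  have h : 0 < ‖p‖ := norm_pos_iff.2 hp0
  have : σ * p 2 * ‖p‖⁻¹ ≤ 4 / 5 := by
    rw [← div_eq_mul_inv, div_le_iff₀ h]; exact hp
  linarith

theorem abs_coord_le_norm (i : Fin 3) (p : R3) : |p i| ≤ ‖p‖ := PiLp.norm_apply_le p i

theorem moderateOn_capBump {U : Set R3} (hU : IsOpen U) (h0 : (0 : R3) ∉ U) :
    ModerateOn U (capBump σ) := by
  have h1 : ModerateOn U fun p : R3 => σ * p 2 * ‖p‖⁻¹ :=
    ModerateOn.mul hU h0 (ContDiff.moderateOn (by fun_prop)) (moderateOn_norm_inv hU h0)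
  have h2 : ContDiff ℝ ∞ fun t : ℝ => Real.smoothTransition (10 * t - 8) :=
    Real.smoothTransition.contDiff.comp (by fun_prop)
  refine h1.contDiff_comp hU h0 h2 (R := |σ|) fun p hp _ => ?_
  have h := norm_pos_of_mem h0 hp
  rw [norm_mul, norm_mul, norm_inv, norm_norm, ← div_eq_mul_inv, div_le_iff₀ h]
  exact mul_le_mul_of_nonneg_left (abs_coord_le_norm 2 p) (abs_nonneg σ)

theorem f_eq (p : R3) : f p = ‖p‖ ^ 2 - 2 * p 2 ^ 2 := by
  rw [norm_sq_R3, f]; ring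

theorem f_neg_of_lt (hσ : σ ^ 2 = 1) {p : R3} (hp : 3 / 4 * ‖p‖ < σ * p 2) :
    1 / 8 * ‖p‖ ^ 2 ≤ -f p ∧ 0 < -f p := by
  have h1 : (3 / 4 * ‖p‖) ^ 2 < p 2 ^ 2 := by
    have h2 : p 2 ^ 2 = (σ * p 2) ^ 2 := by rw [mul_pow, hσ, one_mul]
    rw [h2]
    have := norm_nonneg p
    gcongr
  -- Since `f = ‖p‖² - 2z²`, the bound `1 / 8` is `2 * (3 / 4)² - 1`.
  rw [f_eq]
  constructor <;> nlinarith [sq_nonneg ‖p‖]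

theorem norm_drop {p : R3} (hp : 0 ≤ -f p) : ‖drop p‖ = |p 2| := by
  rw [← Real.sqrt_sq_eq_abs, eq_comm, Real.sqrt_eq_iff_mul_self_eq (sq_nonneg _) (norm_nonneg _),
    ← sq, norm_sq_R3]
  simp only [drop, PiLp.add_apply, PiLp.smul_apply, horizontal_zero, horizontal_one,
    horizontal_two, basisVec_self, smul_eq_mul, mul_one, zero_add]
  rw [Real.sq_sqrt hp, f]
  simp

/-- The root `√(-f)` is moderate on the cone with slope `3 / 4`, while the cutoff already vanishes
below slope `4 / 5`. The gap makes the product zero near every point outside the larger cone except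
the origin. -/
theorem SmoothFlat.capBump_mul_comp_drop (hσ : σ ^ 2 = 1) {g : R3 → ℝ} (hg : SmoothFlat g) :
    SmoothFlat fun p => capBump σ p • g (drop p) := by
  let U : Set R3 := {p | 3 / 4 * ‖p‖ < σ * p 2}
  have hU : IsOpen U := isOpen_lt (by fun_prop) (by fun_prop)
  have h0 : (0 : R3) ∉ U := by simp [U]
  have hs : ModerateOn U fun p => Real.sqrt (-f p) := by
    simp only [Real.sqrt_eq_rpow]
    exact ModerateOn.rpow hU h0 (ContDiff.moderateOn contDiff_f.neg)
      (fun p hp => (f_neg_of_lt hσ hp).2) (c := 1 / 8) (by norm_num)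
      (fun p hp _ => (f_neg_of_lt hσ hp).1) _
  have hd : ModerateOn U drop := by
    refine ModerateOn.add h0 (ContDiff.moderateOn horizontal.contDiff) ?_
    exact hs.smul hU h0 (ContDiff.moderateOn contDiff_const)
  refine ((moderateOn_capBump hU h0).smul_flatOn hU h0
    (hg.comp_flatOn hU h0 hd one_ne_zero (K := 1) fun p hp _ => ?_)).smoothFlat ?_ ?_
  · rw [pow_one, one_mul, norm_drop (f_neg_of_lt hσ hp).2.le]
    exact abs_coord_le_norm 2 p
  · rw [capBump_eq_zero (by simp), zero_smul]
  · intro p hp hp0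
    have hp : σ * p 2 ≤ 3 / 4 * ‖p‖ := not_lt.1 hp
    have hp' : σ * p 2 < 4 / 5 * ‖p‖ := by
      have := norm_pos_iff.2 hp0
      linarith
    have hopen : IsOpen {p : R3 | σ * p 2 < 4 / 5 * ‖p‖} := isOpen_lt (by fun_prop) (by fun_prop)
    filter_upwards [hopen.mem_nhds hp'] with q hq
    rw [capBump_eq_zero (le_of_lt hq), zero_smul, Pi.zero_apply]

theorem fderiv_capBump_smul_of_mem_neg {g : R3 → ℝ} {p : R3} (hp : p ∈ cap (-σ)) :
    fderiv ℝ (fun p => capBump σ p • g (drop p)) p = 0 := by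
  have : (fun p => capBump σ p • g (drop p)) =ᶠ[nhds p] fun _ => 0 := by
    filter_upwards [isOpen_cap.mem_nhds hp] with q hq
    have hq : 9 / 10 * ‖q‖ < -σ * q 2 := hq
    rw [capBump_eq_zero (by have := norm_nonneg q; linarith), zero_smul]
  rw [this.fderiv_eq]
  simp

theorem lt_of_mem_cap {p : R3} (hp : p ∈ cap σ) : 3 / 4 * ‖p‖ < σ * p 2 := by
  have hp : 9 / 10 * ‖p‖ < σ * p 2 := hp
  have := norm_nonneg p
  linarith

theorem hasFDerivAt_drop {p : R3} (hp : 0 < -f p) : HasFDerivAt drop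
    (horizontal + ((1 / (2 * Real.sqrt (-f p))) • -df p).smulRight (basisVec 2)) p := by
  have h1 : HasFDerivAt f (df p) p := (contDiff_f.differentiable (by simp) p).hasFDerivAt
  exact horizontal.hasFDerivAt.add ((h1.neg.sqrt hp.ne').smul_const _)

theorem fderiv_capBump_smul_of_mem (hσ : σ ^ 2 = 1) {g : R3 → ℝ} (hg : Differentiable ℝ g) {p u : R3}
    (hp : p ∈ cap σ) (hu : df p u = 0) :
    fderiv ℝ (fun p => capBump σ p • g (drop p)) p u = fderiv ℝ g (drop p) (horizontal u) := by
  have : (fun p => capBump σ p • g (drop p)) =ᶠ[nhds p] fun p => g (drop p) := by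
    filter_upwards [isOpen_cap.mem_nhds hp] with q hq
    rw [capBump_eq_one hq, one_smul]
  have hd := hasFDerivAt_drop (f_neg_of_lt hσ (lt_of_mem_cap hp)).2
  have hc : fderiv ℝ (fun p => g (drop p)) p = _ :=
    (HasFDerivAt.comp p (hg (drop p)).hasFDerivAt hd).fderiv
  rw [this.fderiv_eq, hc]
  simp [hu]

theorem norm_drop_of_mem_cap (hσ : σ ^ 2 = 1) {p : R3} (hp : p ∈ cap σ) : ‖drop p‖ = σ * p 2 := by
  have hp' := lt_of_mem_cap hp
  have h0 : 0 ≤ σ * p 2 := by have := norm_nonneg p; linarith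
  rw [norm_drop (f_neg_of_lt hσ hp').2.le, ← abs_of_nonneg h0, abs_mul,
    show |σ| = 1 by rw [← sq_eq_sq₀ (abs_nonneg _) zero_le_one, sq_abs, hσ, one_pow], one_mul]

theorem lift_drop (hσ : σ ^ 2 = 1) {p : R3} (hp : p ∈ cap σ) : lift σ (drop p) = p := by
  unfold lift
  rw [norm_drop_of_mem_cap hσ hp]
  refine ext_R3 ?_ ?_ ?_
  · simp [drop]
  · simp [drop]
  · simp [← mul_assoc, ← sq, hσ]

theorem drop_ne_zero (hσ : σ ^ 2 = 1) {p : R3} (hp : p ∈ cap σ) : drop p ≠ 0 := by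
  rw [← norm_ne_zero_iff, norm_drop_of_mem_cap hσ hp]
  have := lt_of_mem_cap hp
  have := norm_nonneg p
  linarith

theorem f_lift (hσ : σ ^ 2 = 1) (q : R3) : f (lift σ q) = -q 2 ^ 2 := by
  have := norm_sq_R3 q
  simp only [f, lift, PiLp.add_apply, PiLp.smul_apply, horizontal_zero, horizontal_one,
    horizontal_two, basisVec_self, smul_eq_mul]
  simp
  rw [mul_pow, hσ]
  linarith

theorem moderateOn_lift : ModerateOn {0}ᶜ (lift σ) := by
  have hU : IsOpen ({0}ᶜ : Set R3) := isOpen_compl_singleton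
  refine ModerateOn.add zero_notMem_compl_zero (ContDiff.moderateOn horizontal.contDiff) ?_
  exact ((ContDiff.moderateOn contDiff_const).mul hU zero_notMem_compl_zero
    (moderateOn_norm hU zero_notMem_compl_zero)).smul hU zero_notMem_compl_zero
    (ContDiff.moderateOn contDiff_const)

theorem norm_lift_sq_le (hσ : σ ^ 2 = 1) {q : R3} (hq : ‖q‖ ≤ 1) : ‖lift σ q‖ ^ 2 ≤ 2 * ‖q‖ := by
  have h1 := norm_sq_R3 q
  have h2 : ‖lift σ q‖ ^ 2 = q 0 ^ 2 + q 1 ^ 2 + ‖q‖ ^ 2 := by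
    rw [norm_sq_R3]
    simp [lift, mul_pow, hσ]
  rw [h2]
  nlinarith [sq_nonneg (q 2), norm_nonneg q]

theorem lift_zero : lift σ 0 = 0 := by simp [lift]

theorem SmoothFlat.comp_lift {F : Type} [NormedAddCommGroup F] [NormedSpace ℝ F] (hσ : σ ^ 2 = 1)
    {g : R3 → F} (hg : SmoothFlat g) : FlatOn {0}ᶜ fun q => g (lift σ q) :=
  hg.comp_flatOn isOpen_compl_singleton zero_notMem_compl_zero moderateOn_lift two_ne_zero
    (K := 2) fun _ _ hp => norm_lift_sq_le hσ hp

/-- A field of covectors is closed along the leaves of the foliation by the levels of `f`. -/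
def LeafwiseClosed (β : R3 → R3 →L[ℝ] ℝ) : Prop :=
  ∀ p u v, df p u = 0 → df p v = 0 → fderiv ℝ β p u v = fderiv ℝ β p v u

/-- The components of the pull-back of `β` along `lift σ`. -/
def liftComponent (σ : ℝ) (β : R3 → R3 →L[ℝ] ℝ) (v : R3) (q : R3) : ℝ :=
  β (lift σ q) (fderiv ℝ (lift σ) q v)

variable {β : R3 → R3 →L[ℝ] ℝ}

theorem SmoothFlat.liftComponent (hσ : σ ^ 2 = 1) (hβ : SmoothFlat β) (v : R3) :
    SmoothFlat (liftComponent σ β v) := by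
  have hU : IsOpen ({0}ᶜ : Set R3) := isOpen_compl_singleton
  refine FlatOn.smoothFlat_of_compl_zero ?_ (by simp [FlatFoliated.liftComponent, lift_zero,
    hβ.apply_zero])
  have h1 : ModerateOn {0}ᶜ fun q => _root_.fderiv ℝ (lift σ) q v :=
    moderateOn_lift.fderiv.bilin hU zero_notMem_compl_zero (ContinuousLinearMap.id ℝ (R3 →L[ℝ] R3))
      (ContDiff.moderateOn (φ := fun _ => v) contDiff_const)
  exact h1.bilin_flatOn hU zero_notMem_compl_zero (ContinuousLinearMap.apply ℝ ℝ) (hβ.comp_lift hσ)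

/-- Because `f ∘ lift σ = -q₂²`, the lift sends planes `q₂ = const` into leaves. -/
theorem df_lift_fderiv (hσ : σ ^ 2 = 1) {q v : R3} (hq : q ≠ 0) (hv : v 2 = 0) :
    df (lift σ q) (fderiv ℝ (lift σ) q v) = 0 := by
  have h1 := HasFDerivAt.comp q ((contDiff_f.differentiable (by simp) (lift σ q)).hasFDerivAt)
    ((moderateOn_lift.smooth q hq).differentiableAt (by simp)).hasFDerivAt
  have h2 : HasFDerivAt (f ∘ lift σ) _ q :=
    ((hasFDerivAt_coord 2 q).pow 2).neg.congr_of_eventuallyEq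
      (Filter.Eventually.of_forall fun q => f_lift hσ q)
  have := congrArg (fun L : R3 →L[ℝ] ℝ => L v) (h1.unique h2)
  unfold df
  simpa [hv] using this

/-- The pull-back of a leafwise closed form to the planes is closed: the second derivatives of `lift
σ` are symmetric and the remaining term is leafwise closedness. At `q = 0`, where the lift is not
smooth, both sides vanish by flatness. -/
theorem fderiv_liftComponent_symm (hσ : σ ^ 2 = 1) (hβ : SmoothFlat β) (hc : LeafwiseClosed β)
    {u v : R3} (hu : u 2 = 0) (hv : v 2 = 0) (q : R3) :
    fderiv ℝ (liftComponent σ β v) q u = fderiv ℝ (liftComponent σ β u) q v := by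
  by_cases hq : q = 0
  · rw [hq, (hβ.liftComponent hσ u).fderiv.apply_zero, (hβ.liftComponent hσ v).fderiv.apply_zero]
    rfl
  have hs := moderateOn_lift (σ := σ).smooth q hq
  have hd : ∀ w, HasFDerivAt (liftComponent σ β w) _ q := fun w =>
    (HasFDerivAt.comp q (hβ.hasFDerivAt (lift σ q)) (hs.differentiableAt (by simp)).hasFDerivAt).clm_apply
      (((hs.fderiv_right (m := ∞) (by simp)).differentiableAt (by simp)).hasFDerivAt.clm_apply
        (hasFDerivAt_const w q))
  have hsymm := hs.isSymmSndFDerivAt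
    (by rw [minSmoothness_of_isRCLikeNormedField]; exact two_le_infty) u v
  rw [(hd u).fderiv, (hd v).fderiv]
  have := hc (lift σ q) _ _ (df_lift_fderiv hσ hq hu) (df_lift_fderiv hσ hq hv)
  simp [hsymm, this]

theorem fderiv_fderiv_symm {g : R3 → ℝ} (hg : ContDiff ℝ ∞ g) (p u v : R3) :
    fderiv ℝ (fderiv ℝ g) p u v = fderiv ℝ (fderiv ℝ g) p v u :=
  hg.contDiffAt.isSymmSndFDerivAt
    (by rw [minSmoothness_of_isRCLikeNormedField]; exact two_le_infty) u v

theorem fderiv_fderiv_apply {g : R3 → ℝ} (hg : ContDiff ℝ ∞ g) (p u v : R3) :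
    fderiv ℝ (fun q => fderiv ℝ g q v) p u = fderiv ℝ (fderiv ℝ g) p u v := by
  have h : HasFDerivAt (fun q => fderiv ℝ g q v) _ p :=
    (((hg.fderiv_right (m := ∞) (by simp)).differentiable (by simp)) p).hasFDerivAt.clm_apply
      (hasFDerivAt_const v p)
  rw [h.fderiv]
  simp

/-- The Poincaré lemma in the planes `z = const`, for flat functions. -/
theorem exists_plane_primitive {a b : R3 → ℝ} (ha : SmoothFlat a) (hb : SmoothFlat b)
    (hab : ∀ q, fderiv ℝ a q (basisVec 1) = fderiv ℝ b q (basisVec 0)) :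
    ∃ g : R3 → ℝ, SmoothFlat g ∧ (∀ q, fderiv ℝ g q (basisVec 0) = a q) ∧
      ∀ q, fderiv ℝ g q (basisVec 1) = b q := by
  let g₁ := primitiveAlong (coord 0) (basisVec 0) a
  have hg₁ : SmoothFlat g₁ := ha.primitiveAlong
  have h₁ : ∀ q, fderiv ℝ g₁ q (basisVec 0) = a q := fderiv_primitiveAlong_self ha (by simp)
  -- Compatibility makes this remainder independent of `x`, so its primitive in `y` leaves the
  -- `x`-derivative of `g₁` untouched.
  let b' : R3 → ℝ := fun q => b q - fderiv ℝ g₁ q (basisVec 1)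
  have hb'1 : SmoothFlat fun q => fderiv ℝ g₁ q (basisVec 1) := hg₁.fderiv.clm_apply contDiff_const
  have hb' : SmoothFlat b' := hb.sub hb'1
  have hb'0 : ∀ q, fderiv ℝ b' q (basisVec 0) = 0 := by
    intro q
    have : fderiv ℝ b' q = _ := ((hb.hasFDerivAt q).sub (hb'1.hasFDerivAt q)).fderiv
    rw [this]
    change fderiv ℝ b q _ - fderiv ℝ (fun q => fderiv ℝ g₁ q (basisVec 1)) q (basisVec 0) = 0
    rw [fderiv_fderiv_apply hg₁.1, fderiv_fderiv_symm hg₁.1, ← fderiv_fderiv_apply hg₁.1,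
      funext h₁, hab, sub_self]
  let g₂ := primitiveAlong (coord 1) (basisVec 1) b'
  have hg₂ : SmoothFlat g₂ := hb'.primitiveAlong
  have hd : ∀ q v, fderiv ℝ (fun q => g₁ q + g₂ q) q v = fderiv ℝ g₁ q v + fderiv ℝ g₂ q v := by
    intro q v
    have : fderiv ℝ (fun q => g₁ q + g₂ q) q = _ :=
      ((hg₁.hasFDerivAt q).add (hg₂.hasFDerivAt q)).fderiv
    rw [this]
    rfl
  refine ⟨fun q => g₁ q + g₂ q, hg₁.add hg₂, fun q => ?_, fun q => ?_⟩
  · rw [hd, h₁, fderiv_primitiveAlong_of_apply_eq_zero hb' _ _ (by simp)]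
    simp [hb'0]
  · rw [hd, fderiv_primitiveAlong_self hb' (by simp)]
    simp [b']

/-- A flat leafwise closed one-form is leafwise exact near the half axis `σ z > 0`. -/
theorem exists_cap_primitive (hσ : σ ^ 2 = 1) (hβ : SmoothFlat β) (hc : LeafwiseClosed β) :
    ∃ g : R3 → ℝ, SmoothFlat g ∧ (∀ p ∈ cap σ, ∀ u, df p u = 0 → fderiv ℝ g p u = β p u) ∧
      ∀ p ∈ cap (-σ), fderiv ℝ g p = 0 := by
  obtain ⟨g, hg, hg0, hg1⟩ := exists_plane_primitive (hβ.liftComponent hσ (basisVec 0))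
    (hβ.liftComponent hσ (basisVec 1)) fun q =>
      fderiv_liftComponent_symm hσ hβ hc (by simp) (by simp) q
  refine ⟨_, hg.capBump_mul_comp_drop hσ, fun p hp u hu => ?_,
    fun p hp => fderiv_capBump_smul_of_mem_neg hp⟩
  rw [fderiv_capBump_smul_of_mem hσ hg.differentiable hp hu]
  have h1 : fderiv ℝ g (drop p) (horizontal u) =
      β (lift σ (drop p)) (fderiv ℝ (lift σ) (drop p) (horizontal u)) := by
    have : horizontal u = u 0 • basisVec 0 + u 1 • basisVec 1 := by
      refine ext_R3 ?_ ?_ ?_ <;> simp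
    rw [this]
    simp only [map_add, map_smul, hg0, hg1]
    rfl
  have hd := hasFDerivAt_drop (f_neg_of_lt hσ (lt_of_mem_cap hp)).2
  have hl := ((moderateOn_lift (σ := σ).smooth _ (drop_ne_zero hσ hp)).differentiableAt
    (by simp)).hasFDerivAt
  have hid : HasFDerivAt (lift σ ∘ drop) (ContinuousLinearMap.id ℝ R3) p :=
    (hasFDerivAt_id p).congr_of_eventuallyEq (by
      filter_upwards [isOpen_cap.mem_nhds hp] with q hq using lift_drop hσ hq)
  have h2 := congrArg (fun L : R3 →L[ℝ] R3 => L u) ((hl.comp p hd).unique hid)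
  simp [hu] at h2
  rw [h1, lift_drop hσ hp, h2]

/-- In the straightened coordinates the leaf-tangent field `z ∂_x + x ∂_z` becomes `z ∂_x`, with `σ
z = ‖q‖`; dividing by `z` and integrating in `x` inverts it. The field arises as the leafwise curl
of `G dy`. -/
theorem exists_cap_derivative_eq (hσ : σ ^ 2 = 1) {h : R3 → ℝ} (hh : SmoothFlat h) :
    ∃ g : R3 → ℝ, SmoothFlat g ∧
      (∀ p ∈ cap σ, fderiv ℝ g p (p 2 • basisVec 0 + p 0 • basisVec 2) = h p) ∧
      ∀ p ∈ cap (-σ), fderiv ℝ g p = 0 := by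
  have hU : IsOpen ({0}ᶜ : Set R3) := isOpen_compl_singleton
  have h1 : SmoothFlat fun q => (σ * ‖q‖⁻¹) • h (lift σ q) := by
    refine FlatOn.smoothFlat_of_compl_zero (((ContDiff.moderateOn contDiff_const).mul hU
      zero_notMem_compl_zero (moderateOn_norm_inv hU zero_notMem_compl_zero)).smul_flatOn hU
      zero_notMem_compl_zero (hh.comp_lift hσ)) (by simp)
  have hg := h1.primitiveAlong (ℓ := coord 0) (e := basisVec 0)
  refine ⟨_, hg.capBump_mul_comp_drop hσ, fun p hp => ?_,
    fun p hp => fderiv_capBump_smul_of_mem_neg hp⟩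
  rw [fderiv_capBump_smul_of_mem hσ hg.differentiable hp (by rw [df_apply]; simp; ring)]
  have : horizontal (p 2 • basisVec 0 + p 0 • basisVec 2) = p 2 • basisVec 0 := by
    refine ext_R3 ?_ ?_ ?_ <;> simp
  rw [this, map_smul, fderiv_primitiveAlong_self h1 (by simp), lift_drop hσ hp,
    norm_drop_of_mem_cap hσ hp]
  have h0 : σ * p 2 ≠ 0 := by
    rw [← norm_drop_of_mem_cap hσ hp]; exact norm_ne_zero_iff.2 (drop_ne_zero hσ hp)
  have h2 : p 2 ≠ 0 := right_ne_zero_of_mul h0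
  have h3 : σ ≠ 0 := left_ne_zero_of_mul h0
  simp only [smul_eq_mul]
  field_simp

theorem mem_cap_of_mem_axisCone {p : R3} (hp : p ∈ axisCone) : p ∈ cap 1 ∨ p ∈ cap (-1) := by
  have hp : 81 * (p 0 ^ 2 + p 1 ^ 2) < 19 * p 2 ^ 2 := hp
  -- Adding `81 z²` to both sides of the inequality defining `axisCone` gives `81 ‖p‖² < 100 z²`.
  have h1 : (9 / 10 * ‖p‖) ^ 2 < |p 2| ^ 2 := by
    rw [mul_pow, norm_sq_R3, sq_abs]; linarith
  have h2 := lt_of_pow_lt_pow_left₀ 2 (abs_nonneg _) h1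
  rcases abs_choice (p 2) with h | h
  · left
    rw [h] at h2
    simpa [cap] using h2
  · right
    rw [h] at h2
    simpa [cap] using h2

end Caps

/-! ### The angular form near the axis, and Casimir functions. -/

noncomputable section Leafwise

variable {β : R3 → R3 →L[ℝ] ℝ}

theorem dθ_apply (p u : R3) : dθ p u = (p 0 ^ 2 + p 1 ^ 2)⁻¹ * (-p 1 * u 0 + p 0 * u 1) := by
  simp [dθ]
  ring

theorem moderateOn_inv_sq_add_sq {U : Set R3} (hU : IsOpen U) (h0 : (0 : R3) ∉ U)
    (h : ∀ p ∈ U, 1 / 10 * ‖p‖ ^ 2 < p 0 ^ 2 + p 1 ^ 2) :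
    ModerateOn U fun p : R3 => (p 0 ^ 2 + p 1 ^ 2)⁻¹ := by
  have := ModerateOn.rpow hU h0 (φ := fun p : R3 => p 0 ^ 2 + p 1 ^ 2)
    (ContDiff.moderateOn (by fun_prop)) (fun p hp => by exact lt_of_le_of_lt (by positivity) (h p hp))
    (c := 1 / 10) (m := 2) (by norm_num) (fun p hp _ => (h p hp).le) (-1)
  simpa only [Real.rpow_neg_one] using this

/-- The complement of a conical neighbourhood of the axis. -/
def offAxis : Set R3 := {p | 1 / 10 * ‖p‖ ^ 2 < p 0 ^ 2 + p 1 ^ 2}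

theorem isOpen_offAxis : IsOpen offAxis := isOpen_lt (by fun_prop) (by fun_prop)

theorem zero_notMem_offAxis : (0 : R3) ∉ offAxis := by simp [offAxis]

theorem mem_axisCone_of_notMem {p : R3} (hp : p ∉ offAxis) (h0 : p ≠ 0) : p ∈ axisCone := by
  have hp : p 0 ^ 2 + p 1 ^ 2 ≤ 1 / 10 * ‖p‖ ^ 2 := not_lt.1 hp
  have hpos : 0 < ‖p‖ ^ 2 := by have := norm_pos_iff.2 h0; positivity
  rw [norm_sq_R3] at hp hpos
  change 81 * (p 0 ^ 2 + p 1 ^ 2) < 19 * p 2 ^ 2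
  linarith

theorem eventuallyEq_zero_of_notMem_offAxis {g : R3 → ℝ} (hg : ∀ p ∈ axisCone, g p = 0) {p : R3}
    (hp : p ∉ offAxis) (h0 : p ≠ 0) : g =ᶠ[nhds p] 0 := by
  filter_upwards [isOpen_axisCone.mem_nhds (mem_axisCone_of_notMem hp h0)] with q hq using hg q hq

/-- Flat functions vanishing near the axis can be divided by `x² + y²`. -/
theorem SmoothFlat.inv_sq_add_sq_mul {g : R3 → ℝ} (hg : SmoothFlat g)
    (hz : ∀ p ∈ axisCone, g p = 0) : SmoothFlat fun p => (p 0 ^ 2 + p 1 ^ 2)⁻¹ • g p :=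
  hg.moderate_smul isOpen_offAxis zero_notMem_offAxis
    (moderateOn_inv_sq_add_sq isOpen_offAxis zero_notMem_offAxis fun _ hp => hp)
    fun _ hp h0 => eventuallyEq_zero_of_notMem_offAxis hz hp h0

theorem SmoothFlat.smul_dθ {g : R3 → ℝ} (hg : SmoothFlat g) (hz : ∀ p ∈ axisCone, g p = 0) :
    SmoothFlat fun p => g p • dθ p := by
  have h := (hg.inv_sq_add_sq_mul hz).smul_smooth (φ := fun p : R3 => -(p 1) • coord 0 + p 0 • coord 1)
    (by fun_prop)
  convert h using 2 with p
  rw [dθ, smul_smul, smul_eq_mul, mul_comm (g p)]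

theorem fderiv_smul_dθ {g : R3 → ℝ} (hg : Differentiable ℝ g) {p : R3} (hp : p 0 ^ 2 + p 1 ^ 2 ≠ 0)
    (u v : R3) : fderiv ℝ (fun p => g p • dθ p) p u v =
      fderiv ℝ g p u * dθ p v + g p * ((p 0 ^ 2 + p 1 ^ 2)⁻¹ * (-u 1 * v 0 + u 0 * v 1) -
        ((p 0 ^ 2 + p 1 ^ 2) ^ 2)⁻¹ * (2 * (p 0 * u 0 + p 1 * u 1)) * (-p 1 * v 0 + p 0 * v 1)) := by
  have h1 : HasFDerivAt (fun p : R3 => -(p 1) • coord 0 + p 0 • coord 1) _ p :=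
    ((hasFDerivAt_coord 1 p).neg.smul_const (coord 0)).add ((hasFDerivAt_coord 0 p).smul_const (coord 1))
  have h2 := (((hasFDerivAt_coord 0 p).pow 2).add ((hasFDerivAt_coord 1 p).pow 2))
  have h3 : HasFDerivAt (fun p : R3 => (p 0 ^ 2 + p 1 ^ 2)⁻¹) _ p :=
    (hasDerivAt_inv hp).comp_hasFDerivAt p h2
  have h4 : fderiv ℝ (fun p => g p • dθ p) p = _ :=
    ((hg p).hasFDerivAt.smul (h3.smul h1)).fderiv
  rw [h4]
  simp [dθ]
  ring

theorem axis_ne_zero {p : R3} (hp : p 0 ^ 2 + p 1 ^ 2 ≠ 0) : p ≠ 0 := by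
  rintro rfl; simp at hp

/-- Casimir functions are constant along the leaves. -/
theorem IsCasimir.fderiv_eq_zero {g : R3 → ℝ} (hg : IsCasimir g) {p u : R3} (hp : p ≠ 0)
    (hu : df p u = 0) : fderiv ℝ g p u = 0 := by
  have h : ∀ i j, pd j (fun q : R3 => q i) p = if i = j then 1 else 0 := by
    intro i j
    rw [pd, (hasFDerivAt_coord i p).fderiv]
    simp
  have h0 := hg.2 (fun q => q 0) (by fun_prop) p
  have h1 := hg.2 (fun q => q 1) (by fun_prop) p
  have h2 := hg.2 (fun q => q 2) (by fun_prop) p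
  simp only [poissonBracket, h] at h0 h1 h2
  simp at h0 h1 h2
  have hexp : fderiv ℝ g p u = u 0 * pd 0 g p + u 1 * pd 1 g p + u 2 * pd 2 g p := by
    have : u = u 0 • basisVec 0 + u 1 • basisVec 1 + u 2 • basisVec 2 := by
      refine ext_R3 ?_ ?_ ?_ <;> simp
    conv_lhs => rw [this]
    simp [pd]
  have hpos : p 0 ^ 2 + p 1 ^ 2 + p 2 ^ 2 ≠ 0 := by
    rw [← norm_sq_R3]; have := norm_pos_iff.2 hp; positivity
  rw [df_apply] at hu
  -- The brackets with the coordinates say that the gradient of `g` is parallel to `(x, y, -z)`.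
  -- Multiplying by `‖p‖²` writes the derivative as an explicit combination of these relations and
  -- of `df p u = 0`.
  refine (mul_eq_zero.1 (?_ : (p 0 ^ 2 + p 1 ^ 2 + p 2 ^ 2) * fderiv ℝ g p u = 0)).resolve_left hpos
  rw [hexp]
  linear_combination (pd 0 g p * p 0 + pd 1 g p * p 1 - pd 2 g p * p 2) * hu / 2 +
    (p 2 * u 1 + p 1 * u 2) * h0 + (-(p 2) * u 0 - p 0 * u 2) * h1 + (-(p 1) * u 0 + p 0 * u 1) * h2

/-- The bracket is the derivative of `g` along a combination of the tangent fields `y ∂_z + z ∂_y`,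
`x ∂_z + z ∂_x` and `x ∂_y - y ∂_x`. Continuity fills in the axis. -/
theorem isCasimir_of_fderiv_eq_zero {g : R3 → ℝ} (hg : ContDiff ℝ ∞ g)
    (h : ∀ p, p 0 ^ 2 + p 1 ^ 2 ≠ 0 → ∀ u, df p u = 0 → fderiv ℝ g p u = 0) : IsCasimir g := by
  refine ⟨hg, fun φ hφ p => ?_⟩
  have hc : ∀ ψ : R3 → ℝ, ContDiff ℝ ∞ ψ → ∀ i, Continuous (pd i ψ) := fun ψ hψ i =>
    (hψ.continuous_fderiv (by simp)).clm_apply continuous_const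
  have hcont : Continuous (poissonBracket g φ) := by
    have := hc g hg
    have := hc φ hφ
    unfold poissonBracket
    fun_prop
  refine eq_zero_of_off_axis hcont (continuous_const (y := (0 : ℝ))) (fun p hp => ?_) p
  have h0 := h p hp (p 1 • basisVec 2 + p 2 • basisVec 1) (by rw [df_apply]; simp; ring)
  have h1 := h p hp (p 0 • basisVec 2 + p 2 • basisVec 0) (by rw [df_apply]; simp; ring)
  have h2 := h p hp (p 0 • basisVec 1 - p 1 • basisVec 0) (by rw [df_apply]; simp; ring)
  simp only [map_add, map_sub, map_smul, smul_eq_mul] at h0 h1 h2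
  simp only [poissonBracket, pd]
  linear_combination (fderiv ℝ φ p (basisVec 0)) * h0 - (fderiv ℝ φ p (basisVec 1)) * h1 +
    (fderiv ℝ φ p (basisVec 2)) * h2

theorem eq_zero_of_mem_COut {η : R3 → ℝ} (hη : η ∈ COut) {p : R3} (hp : f p < 0) : η p = 0 := by
  refine image_eq_zero_of_notMem_tsupport fun h => ?_
  have hcl : closure {p | 0 < f p} ⊆ {p | 0 ≤ f p} :=
    closure_minimal (fun q (hq : 0 < f q) => hq.le) (isClosed_le continuous_const contDiff_f.continuous)
  exact absurd (hcl (hη.2 h)) (not_le.2 hp)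

theorem f_neg_of_mem_axisCone {p : R3} (hp : p ∈ axisCone) : f p < 0 := by
  have hp : 81 * (p 0 ^ 2 + p 1 ^ 2) < 19 * p 2 ^ 2 := hp
  rw [f]
  nlinarith [sq_nonneg (p 2), sq_nonneg (p 0), sq_nonneg (p 1)]

/-- The axis without the origin lies in the open set `f < 0`, where `η` is zero; all derivatives
vanish along it, hence at the origin by continuity. -/
theorem smoothFlat_of_mem_COut {η : R3 → ℝ} (hη : η ∈ COut) : SmoothFlat η := by
  refine ⟨hη.1.1, fun k => ?_⟩
  have hc : Continuous fun t : ℝ => iteratedFDeriv ℝ k η (t • basisVec 2) :=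
    (hη.1.1.continuous_iteratedFDeriv (by exact_mod_cast le_top)).comp (by fun_prop)
  have key : Set.EqOn (fun t : ℝ => iteratedFDeriv ℝ k η (t • basisVec 2)) (fun _ => 0) {0}ᶜ := by
    intro t ht
    have ht : t ≠ 0 := ht
    have hf : f (t • basisVec 2) < 0 := by
      have : 0 < t ^ 2 := by positivity
      simpa [f] using this
    have : η =ᶠ[nhds (t • basisVec 2)] fun _ => 0 := by
      filter_upwards [(isOpen_lt contDiff_f.continuous continuous_const).mem_nhds hf] with q hq
        using eq_zero_of_mem_COut hη hq
    change iteratedFDeriv ℝ k η (t • basisVec 2) = 0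
    rw [(this.iteratedFDeriv ℝ k).eq_of_nhds]
    simp
  have := congrFun (Continuous.ext_on (dense_compl_singleton (0 : ℝ)) hc continuous_const key) 0
  simpa using this

/-- A Casimir function which vanishes near the axis vanishes where `f < 0`. -/
theorem IsCasimir.eq_zero_of_f_neg {η : R3 → ℝ} (hη : IsCasimir η) (hz : ∀ p ∈ axisCone, η p = 0)
    {p : R3} (hp : f p < 0) : η p = 0 := by
  obtain ⟨σ, hσ, hσp⟩ : ∃ σ : ℝ, σ ^ 2 = 1 ∧ σ * |p 2| = p 2 := by
    rcases abs_choice (p 2) with h | h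
    · exact ⟨1, by norm_num, by rw [h, one_mul]⟩
    · exact ⟨-1, by norm_num, by rw [h]; ring⟩
  have hp' : 0 < -f p := by linarith
  let s := Real.sqrt (-f p)
  have hs : 0 < s := Real.sqrt_pos.2 hp'
  -- The lift of this segment is a path in the leaf of `p` from the axis, at `t = 0`, to `p`, at `t
  -- = 1`; `η` is constant on it.
  let q : ℝ → R3 := fun t => t • horizontal p + s • basisVec 2
  have hq2 : ∀ t, q t 2 = s := fun t => by simp [q]
  have hq : ∀ t, q t ≠ 0 := fun t h => by
    have := hq2 t
    rw [h] at this
    exact hs.ne this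
  have hqd : ∀ t, HasDerivAt q (horizontal p) t := fun t => by
    refine (((hasDerivAt_id t).smul_const (horizontal p)).add_const (s • basisVec 2)).congr_deriv ?_
    rw [one_smul]
  have hd : ∀ t, HasDerivAt (fun t => η (lift σ (q t))) 0 t := fun t => by
    have h1 := ((moderateOn_lift (σ := σ)).smooth (q t) (hq t)).differentiableAt (by simp)
    have h2 := h1.hasFDerivAt.comp_hasDerivAt t (hqd t)
    have h3 := (hη.1.differentiable (by simp) (lift σ (q t))).hasFDerivAt.comp_hasDerivAt t h2
    refine h3.congr_deriv (hη.fderiv_eq_zero ?_ (df_lift_fderiv hσ (hq t) (by simp)))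
    intro h
    have := f_lift hσ (q t)
    rw [h, hq2] at this
    simp [f] at this
    exact hs.ne' this
  have hconst := is_const_of_deriv_eq_zero (fun t => (hd t).differentiableAt)
    (fun t => (hd t).deriv) 1 0
  have h1 : lift σ (q 1) = p := by
    have : q 1 = drop p := by simp [q, drop, s]
    rw [this, lift, norm_drop hp'.le, hσp]
    refine ext_R3 ?_ ?_ ?_ <;> simp [drop]
  rw [h1] at hconst
  rw [hconst]
  refine hz _ ?_
  have hσ0 : σ ≠ 0 := by rintro rfl; norm_num at hσ
  have : ‖q 0‖ ≠ 0 := norm_ne_zero_iff.2 (hq 0)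
  have h0 : lift σ (q 0) 0 = 0 := by simp [lift, q]
  have h1 : lift σ (q 0) 1 = 0 := by simp [lift, q]
  have h2 : lift σ (q 0) 2 = σ * ‖q 0‖ := by simp [lift]
  change 81 * (lift σ (q 0) 0 ^ 2 + lift σ (q 0) 1 ^ 2) < 19 * lift σ (q 0) 2 ^ 2
  rw [h0, h1, h2]
  have : 0 < (σ * ‖q 0‖) ^ 2 := by positivity
  linarith

/-- It remains to treat `f = 0`: off the axis such a point is a limit of points with `f > 0`,
obtained by moving away from the axis, and at the origin `η` vanishes by continuity from the axis.
-/
theorem IsCasimir.mem_COut {η : R3 → ℝ} (hη : IsCasimir η) (hz : ∀ p ∈ axisCone, η p = 0) :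
    η ∈ COut := by
  refine ⟨hη, closure_minimal (fun p hp => ?_) isClosed_closure⟩
  by_contra hcl
  refine hp ?_
  by_cases hax : p 0 ^ 2 + p 1 ^ 2 = 0
  · by_cases hp0 : p = 0
    · have h0 : p ∈ closure axisCone := by
        rw [hp0]
        refine mem_closure_of_tendsto (f := fun n : ℕ => (1 / ((n : ℝ) + 1)) • basisVec 2)
          (b := Filter.atTop) ?_ (Filter.Eventually.of_forall fun n => ?_)
        · simpa using (tendsto_one_div_add_atTop_nhds_zero_nat (𝕜 := ℝ)).smul_const (basisVec 2)
        · have : (0 : ℝ) < (n : ℝ) + 1 := by positivity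
          simp [axisCone]
          positivity
      exact closure_minimal (s := axisCone) (t := {p | η p = 0}) hz
        (isClosed_eq hη.1.continuous continuous_const) h0
    · refine hz p (mem_axisCone_of_notMem (fun h => ?_) hp0)
      have h : 1 / 10 * ‖p‖ ^ 2 < p 0 ^ 2 + p 1 ^ 2 := h
      have := sq_nonneg ‖p‖
      linarith
  · have hle : f p ≤ 0 := by
      by_contra h
      exact hcl (subset_closure (not_le.1 h))
    rcases hle.lt_or_eq with h | h
    · exact hη.eq_zero_of_f_neg hz h
    · exfalso
      refine hcl (mem_closure_of_tendsto
        (f := fun n : ℕ => p + (1 / ((n : ℝ) + 1)) • horizontal p) (b := Filter.atTop) ?_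
        (Filter.Eventually.of_forall fun n => ?_))
      · simpa using ((tendsto_one_div_add_atTop_nhds_zero_nat (𝕜 := ℝ)).smul_const
          (horizontal p)).const_add p
      · have : (0 : ℝ) < 1 / ((n : ℝ) + 1) := by positivity
        generalize 1 / ((n : ℝ) + 1) = e at this
        have hax' : 0 < p 0 ^ 2 + p 1 ^ 2 := lt_of_le_of_ne (by positivity) (Ne.symm hax)
        have : f (p + e • horizontal p) = f p + (2 * e + e ^ 2) * (p 0 ^ 2 + p 1 ^ 2) := by
          simp [f]; ring
        change 0 < f (p + e • horizontal p)
        rw [this, h]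
        positivity

end Leafwise

/-! ### Solving the leafwise equations in degrees one and two. -/

noncomputable section Decomposition

variable {β : R3 → R3 →L[ℝ] ℝ}

theorem fderiv_sub_fderiv_apply {g : R3 → ℝ} (hβ : SmoothFlat β) (hg : SmoothFlat g) (p u v : R3) :
    fderiv ℝ (fun q => β q - fderiv ℝ g q) p u v =
      fderiv ℝ β p u v - fderiv ℝ (fderiv ℝ g) p u v := by
  have : fderiv ℝ (fun q => β q - fderiv ℝ g q) p = _ :=
    ((hβ.hasFDerivAt p).sub (hg.fderiv.hasFDerivAt p)).fderiv
  rw [this]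
  rfl

theorem LeafwiseClosed.sub_fderiv {g : R3 → ℝ} (hc : LeafwiseClosed β) (hβ : SmoothFlat β)
    (hg : SmoothFlat g) : LeafwiseClosed fun q => β q - fderiv ℝ g q := by
  intro p u v hu hv
  rw [fderiv_sub_fderiv_apply hβ hg, fderiv_sub_fderiv_apply hβ hg, hc p u v hu hv,
    fderiv_fderiv_symm hg.1]

/-- The commuting fields `rotGen` and `boost` turn a leafwise closed form into a closed form on
the plane. -/
theorem LeafwiseClosed.fderiv_boost_rotGen (hc : LeafwiseClosed β) (hβ : SmoothFlat β) (p : R3) :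
    fderiv ℝ (fun q => β q (boost q)) p (rotGen p) =
      fderiv ℝ (fun q => β q (rotGen q)) p (boost p) := by
  have h1 : fderiv ℝ (fun q => β q (boost q)) p = _ := ((hβ.hasFDerivAt p).clm_apply
    (contDiff_boost.differentiable (by simp) p).hasFDerivAt).fderiv
  have h2 : fderiv ℝ (fun q => β q (rotGen q)) p = _ := ((hβ.hasFDerivAt p).clm_apply
    rotGen.hasFDerivAt).fderiv
  rw [h1, h2]
  have := hc p _ _ (df_rotGen p) (df_boost p)
  simp [fderiv_boost_apply_rotGen, this]

theorem fderiv_eq_zero_of_axisCone {g : R3 → ℝ} (hg : ∀ p ∈ axisCone, g p = 0) {p : R3}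
    (hp : p ∈ axisCone) : fderiv ℝ g p = 0 := by
  have : g =ᶠ[nhds p] fun _ => 0 := by
    filter_upwards [isOpen_axisCone.mem_nhds hp] with q hq using hg q hq
  rw [this.fderiv_eq]
  simp

/-- A flat leafwise closed one-form is leafwise exact near the axis, with flat primitive. -/
theorem exists_axisCone_primitive (hβ : SmoothFlat β) (hc : LeafwiseClosed β) :
    ∃ g : R3 → ℝ, SmoothFlat g ∧ ∀ p ∈ axisCone, ∀ u, df p u = 0 → fderiv ℝ g p u = β p u := by
  obtain ⟨g, hg, hg1, hg2⟩ := exists_cap_primitive (σ := 1) (by norm_num) hβ hc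
  obtain ⟨g', hg', hg1', hg2'⟩ := exists_cap_primitive (σ := -1) (by norm_num) hβ hc
  refine ⟨fun p => g p + g' p, hg.add hg', fun p hp u hu => ?_⟩
  have hd : fderiv ℝ (fun p => g p + g' p) p = _ :=
    ((hg.hasFDerivAt p).add (hg'.hasFDerivAt p)).fderiv
  rw [hd]
  rcases mem_cap_of_mem_axisCone hp with h | h
  · simp [hg1 p h u hu, hg2' p (by simpa using h)]
  · simp [hg1' p h u hu, hg2 p h]

/-- Along `rotGen` a mean over circles does not change. Along `boost`, closedness turns the
derivative of `β(rotGen)` into the `rotGen`-derivative of `β(boost)`, whose integral over a circle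
is zero. -/
theorem circleMean_isCasimir (hβ : SmoothFlat β) (hc : LeafwiseClosed β) :
    IsCasimir (circleMean fun p => β p (rotGen p)) := by
  have hb : SmoothFlat fun p => β p (rotGen p) := hβ.clm_apply rotGen.contDiff
  have hv : SmoothFlat fun p => β p (boost p) := hβ.clm_apply contDiff_boost
  refine isCasimir_of_fderiv_eq_zero hb.circleMean.1 fun p hp u hu => ?_
  rw [eq_of_df_eq_zero hp hu, map_add, map_smul, map_smul, fderiv_circleMean_rotGen hb.1,
    fderiv_circleMean hb.1]
  simp only [rot_boost, ← hc.fderiv_boost_rotGen hβ]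
  rw [integral_fderiv_rotGen hv.1]
  simp

/-- A flat leafwise closed one-form is leafwise cohomologous to `η dθ` with `η ∈ COut`. -/
theorem exists_leafwise_decomposition (hβ : SmoothFlat β) (hc : LeafwiseClosed β) :
    ∃ η ∈ COut, ∃ g : R3 → ℝ, SmoothFlat g ∧ ∀ p, p 0 ^ 2 + p 1 ^ 2 ≠ 0 → ∀ u, df p u = 0 →
      β p u = fderiv ℝ g p u + η p * dθ p u := by
  obtain ⟨g₁, hg₁, h₁⟩ := exists_axisCone_primitive hβ hc
  set β₁ : R3 → R3 →L[ℝ] ℝ := fun p => β p - fderiv ℝ g₁ p with hβ₁_def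
  have hβ₁ : SmoothFlat β₁ := hβ.sub hg₁.fderiv
  have hc₁ : LeafwiseClosed β₁ := hc.sub_fderiv hβ hg₁
  have hz₁ : ∀ p ∈ axisCone, ∀ u, df p u = 0 → β₁ p u = 0 := fun p hp u hu => by
    change β p u - fderiv ℝ g₁ p u = 0
    rw [h₁ p hp u hu, sub_self]
  set b : R3 → ℝ := fun p => β₁ p (rotGen p) with hb_def
  have hb : SmoothFlat b := hβ₁.clm_apply rotGen.contDiff
  have hbz : ∀ p ∈ axisCone, b p = 0 := fun p hp => hz₁ p hp _ (df_rotGen p)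
  have hηC : IsCasimir (circleMean b) := circleMean_isCasimir hβ₁ hc₁
  have hη := hηC.mem_COut fun p hp => circleMean_eq_zero_of_mem_axisCone hbz hp
  have hg₂ := hb.circlePrimitive
  set g₂ := circlePrimitive b with hg₂_def
  have hg₂z : ∀ p ∈ axisCone, g₂ p = 0 := fun p hp =>
    circlePrimitive_eq_zero_of_mem_axisCone hbz hp
  set β₂ : R3 → R3 →L[ℝ] ℝ := fun p => β₁ p - fderiv ℝ g₂ p with hβ₂_def
  have hβ₂ : SmoothFlat β₂ := hβ₁.sub hg₂.fderiv
  have hc₂ : LeafwiseClosed β₂ := hc₁.sub_fderiv hβ₁ hg₂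
  have hrot : ∀ p, β₂ p (rotGen p) = circleMean b p := fun p => by
    change b p - fderiv ℝ (circlePrimitive b) p (rotGen p) = _
    rw [fderiv_circlePrimitive_rotGen hb.1]
    ring
  have hv : SmoothFlat fun p => β₂ p (boost p) := hβ₂.clm_apply contDiff_boost
  have hvz : ∀ p ∈ axisCone, β₂ p (boost p) = 0 := fun p hp => by
    change β₁ p (boost p) - fderiv ℝ g₂ p (boost p) = 0
    rw [hz₁ p hp _ (df_boost p), fderiv_eq_zero_of_axisCone hg₂z hp]
    simp
  -- Closedness again: the `rotGen`-derivative of `β₂(boost)` is the `boost`-derivative of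
  -- `β₂(rotGen) = η`, which is zero since `η` is Casimir.
  have hvinv : ∀ p, p 0 ^ 2 + p 1 ^ 2 ≠ 0 →
      fderiv ℝ (fun p => β₂ p (boost p)) p (rotGen p) = 0 := fun p hp => by
    rw [hc₂.fderiv_boost_rotGen hβ₂, funext hrot]
    exact hηC.fderiv_eq_zero (axis_ne_zero hp) (df_boost p)
  have hw := hv.inv_sq_add_sq_mul hvz
  have hwinv : ∀ p, fderiv ℝ (fun p => (p 0 ^ 2 + p 1 ^ 2)⁻¹ • β₂ p (boost p)) p (rotGen p) = 0 := by
    refine fun p => eq_zero_of_off_axis (hw.fderiv.1.continuous.clm_apply rotGen.continuous)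
      continuous_const (fun p hp => ?_) p
    have h2 := (((hasFDerivAt_coord 0 p).pow 2).add ((hasFDerivAt_coord 1 p).pow 2))
    have h3 : HasFDerivAt (fun p : R3 => (p 0 ^ 2 + p 1 ^ 2)⁻¹) _ p :=
      (hasDerivAt_inv hp).comp_hasFDerivAt p h2
    have h4 : fderiv ℝ (fun p => (p 0 ^ 2 + p 1 ^ 2)⁻¹ • β₂ p (boost p)) p = _ :=
      (h3.smul (hv.hasFDerivAt p)).fderiv
    rw [h4]
    simp [hvinv p hp]
    ring_nf
    simp
  obtain ⟨g₃, hg₃, -, hg₃r, hg₃b⟩ := exists_boost_primitive hw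
    (fun p hp => by rw [hvz p hp, smul_zero]) hwinv
  refine ⟨_, hη, fun p => g₁ p + g₂ p + g₃ p, (hg₁.add hg₂).add hg₃, fun p hp u hu => ?_⟩
  have hd : fderiv ℝ (fun p => g₁ p + g₂ p + g₃ p) p = _ :=
    (((hg₁.hasFDerivAt p).add (hg₂.hasFDerivAt p)).add (hg₃.hasFDerivAt p)).fderiv
  have hβu : β p u = fderiv ℝ g₁ p u + fderiv ℝ g₂ p u + β₂ p u := by
    change _ = fderiv ℝ g₁ p u + fderiv ℝ g₂ p u + (β p u - fderiv ℝ g₁ p u - fderiv ℝ g₂ p u)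
    ring
  have h3 : β₂ p u = fderiv ℝ g₃ p u + circleMean b p * dθ p u := by
    rw [dθ_apply]
    conv_lhs => rw [eq_of_df_eq_zero hp hu]
    conv_rhs => enter [1]; rw [eq_of_df_eq_zero hp hu]
    simp only [map_add, map_smul, hg₃r, hg₃b, hrot, smul_eq_mul]
    field_simp
    ring
  rw [hβu, h3, hd]
  change _ = fderiv ℝ g₁ p u + fderiv ℝ g₂ p u + fderiv ℝ g₃ p u + circleMean b p * dθ p u
  ring

/-- The leafwise period of `η dθ` determines `η`. -/
theorem eq_zero_of_leafwise_exact {η g : R3 → ℝ} (hη : IsCasimir η) (hg : ContDiff ℝ ∞ g)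
    (h : ∀ p, p 0 ^ 2 + p 1 ^ 2 ≠ 0 → ∀ u, df p u = 0 → η p * dθ p u = fderiv ℝ g p u) (p : R3) :
    η p = 0 := by
  refine eq_zero_of_off_axis hη.1.continuous continuous_const (fun p hp => ?_) p
  have hinv : ∀ q, fderiv ℝ η q (rotGen q) = 0 := fun q => by
    by_cases hq : q = 0
    · simp [hq]
    · exact hη.fderiv_eq_zero hq (df_rotGen q)
  have h1 : ∀ q, q 0 ^ 2 + q 1 ^ 2 ≠ 0 → fderiv ℝ g q (rotGen q) = η q := fun q hq => by
    rw [← h q hq _ (df_rotGen q), dθ_apply]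
    simp only [rotGen_zero, rotGen_one]
    field_simp
    ring
  have h2 := integral_fderiv_rotGen hg p
  -- Since `dθ(rotGen) = 1`, the derivative of `g` along the circle is the constant `η p`, while its
  -- integral over the full circle is zero.
  have h3 : ∀ t, fderiv ℝ g (rot t p) (rotGen (rot t p)) = η p := fun t => by
    rw [h1 _ (by rwa [sq_add_sq_rot]), comp_rot_eq hη.1 hinv]
  simpa [h3] using h2

/-- The coefficient of `df ∧ dβ`. -/
def leafwiseCurl (β : R3 → R3 →L[ℝ] ℝ) (p : R3) : ℝ :=
  df p (basisVec 0) * (fderiv ℝ β p (basisVec 1) (basisVec 2) -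
      fderiv ℝ β p (basisVec 2) (basisVec 1)) +
    df p (basisVec 1) * (fderiv ℝ β p (basisVec 2) (basisVec 0) -
      fderiv ℝ β p (basisVec 0) (basisVec 2)) +
    df p (basisVec 2) * (fderiv ℝ β p (basisVec 0) (basisVec 1) -
      fderiv ℝ β p (basisVec 1) (basisVec 0))

theorem leafwiseCurl_add {β γ : R3 → R3 →L[ℝ] ℝ} (hβ : SmoothFlat β) (hγ : SmoothFlat γ) (p : R3) :
    leafwiseCurl (fun p => β p + γ p) p = leafwiseCurl β p + leafwiseCurl γ p := by
  have : fderiv ℝ (fun p => β p + γ p) p = _ := ((hβ.hasFDerivAt p).add (hγ.hasFDerivAt p)).fderiv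
  simp only [leafwiseCurl, this]
  simp
  ring

theorem fderiv_smul_const_apply {g : R3 → ℝ} (hg : Differentiable ℝ g) (φ : R3 →L[ℝ] ℝ) (p u v : R3) :
    fderiv ℝ (fun p => g p • φ) p u v = fderiv ℝ g p u * φ v := by
  have : fderiv ℝ (fun p => g p • φ) p = _ := ((hg p).hasFDerivAt.smul_const φ).fderiv
  rw [this]
  simp

theorem leafwiseCurl_smul_coord_one {g : R3 → ℝ} (hg : Differentiable ℝ g) (p : R3) :
    leafwiseCurl (fun p => g p • coord 1) p =
      -2 * fderiv ℝ g p (p 2 • basisVec 0 + p 0 • basisVec 2) := by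
  simp only [leafwiseCurl, fderiv_smul_const_apply hg, df_apply]
  simp
  ring

theorem leafwiseCurl_smul_coord_two {g : R3 → ℝ} (hg : Differentiable ℝ g) (p : R3) :
    leafwiseCurl (fun p => g p • coord 2) p = 2 * fderiv ℝ g p (rotGen p) := by
  have : rotGen p = p 0 • basisVec 1 - p 1 • basisVec 0 := by simp [rotGen]
  simp only [leafwiseCurl, fderiv_smul_const_apply hg, df_apply, this]
  simp
  ring

theorem leafwiseCurl_smul_dθ {g : R3 → ℝ} (hg : Differentiable ℝ g) {p : R3}
    (hp : p 0 ^ 2 + p 1 ^ 2 ≠ 0) :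
    leafwiseCurl (fun p => g p • dθ p) p =
      -2 * (p 0 ^ 2 + p 1 ^ 2)⁻¹ * fderiv ℝ g p (boost p) := by
  have : boost p = (p 2 * p 0) • basisVec 0 + (p 2 * p 1) • basisVec 1 +
      (p 0 ^ 2 + p 1 ^ 2) • basisVec 2 := by
    refine ext_R3 ?_ ?_ ?_ <;> simp [mul_comm]
  simp only [leafwiseCurl, fderiv_smul_dθ hg hp, df_apply, dθ_apply, this]
  simp
  field_simp
  ring

theorem continuous_leafwiseCurl (hβ : SmoothFlat β) : Continuous (leafwiseCurl β) := by
  have h : ∀ i j, Continuous fun p => fderiv ℝ β p (basisVec i) (basisVec j) := fun i j =>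
    (hβ.fderiv.1.continuous.clm_apply continuous_const).clm_apply continuous_const
  have h' : ∀ i, Continuous fun p => df p (basisVec i) := fun i =>
    (contDiff_f.continuous_fderiv (by simp)).clm_apply continuous_const
  exact (((h' 0).mul ((h 1 2).sub (h 2 1))).add ((h' 1).mul ((h 2 0).sub (h 0 2)))).add
    ((h' 2).mul ((h 0 1).sub (h 1 0)))

/-- Every flat function is the coefficient of `df ∧ dβ` for a flat `β`. -/
theorem exists_leafwiseCurl_eq {h : R3 → ℝ} (hh : SmoothFlat h) :
    ∃ β : R3 → R3 →L[ℝ] ℝ, SmoothFlat β ∧ ∀ p, leafwiseCurl β p = h p := by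
  obtain ⟨g, hg, hg1, hg2⟩ := exists_cap_derivative_eq (σ := 1) (by norm_num) hh
  obtain ⟨g', hg', hg1', hg2'⟩ := exists_cap_derivative_eq (σ := -1) (by norm_num) hh
  -- The factor cancels the `-2` in the curl of `G dy`, so `G dy` solves the equation near the axis.
  -- Each summand has zero derivative on the other cap.
  set G : R3 → ℝ := fun p => (-(1 / 2) : ℝ) • (g p + g' p) with hG_def
  have hG : SmoothFlat G := (hg.add hg').const_smul _
  set β₁ : R3 → R3 →L[ℝ] ℝ := fun p => G p • coord 1 with hβ₁_def
  have hβ₁ : SmoothFlat β₁ := hG.smul_smooth contDiff_const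
  have hcurl₁ : ∀ p, leafwiseCurl β₁ p = -2 * fderiv ℝ G p (p 2 • basisVec 0 + p 0 • basisVec 2) :=
    leafwiseCurl_smul_coord_one hG.differentiable
  have hax : ∀ p ∈ axisCone, leafwiseCurl β₁ p = h p := fun p hp => by
    have hd : fderiv ℝ G p = _ :=
      (((hg.hasFDerivAt p).add (hg'.hasFDerivAt p)).const_smul (-(1 / 2) : ℝ)).fderiv
    rw [hcurl₁, hd]
    rcases mem_cap_of_mem_axisCone hp with hc | hc
    · have h1 := hg1 p hc
      have h2 := hg2' p (by simpa using hc)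
      generalize p 2 • basisVec 0 + p 0 • basisVec 2 = v at h1 ⊢
      simp [h1, h2]
    · have h1 := hg1' p hc
      have h2 := hg2 p hc
      generalize p 2 • basisVec 0 + p 0 • basisVec 2 = v at h1 ⊢
      simp [h1, h2]
  have hr : SmoothFlat fun p => h p - leafwiseCurl β₁ p := by
    simp only [hcurl₁]
    exact hh.sub ((hG.fderiv.clm_apply (by fun_prop)).smooth_mul contDiff_const)
  set r : R3 → ℝ := fun p => h p - leafwiseCurl β₁ p with hr_def
  have hrz : ∀ p ∈ axisCone, r p = 0 := fun p hp => by rw [hr_def]; simp only [hax p hp, sub_self]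
  -- The curl of `P dz` is twice the rotational derivative of `P`, so this removes all of `r` except
  -- its circle mean.
  have hP : SmoothFlat fun p => (1 / 2 : ℝ) • circlePrimitive r p := hr.circlePrimitive.const_smul _
  set β₂ : R3 → R3 →L[ℝ] ℝ := fun p => ((1 / 2 : ℝ) • circlePrimitive r p) • coord 2 with hβ₂_def
  have hβ₂ : SmoothFlat β₂ := hP.smul_smooth contDiff_const
  have hcurl₂ : ∀ p, leafwiseCurl β₂ p = r p - circleMean r p := fun p => by
    have hd : fderiv ℝ (fun p => (1 / 2 : ℝ) • circlePrimitive r p) p = _ :=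
      ((hr.circlePrimitive.hasFDerivAt p).const_smul (1 / 2 : ℝ)).fderiv
    have h1 := fderiv_circlePrimitive_rotGen hr.1 p
    rw [hβ₂_def, leafwiseCurl_smul_coord_two hP.differentiable, hd]
    change 2 * ((1 / 2 : ℝ) * fderiv ℝ (circlePrimitive r) p (rotGen p)) = _
    rw [h1]
    ring
  -- The mean is rotation invariant and vanishes near the axis; the curl of `Q dθ` is `-2 / (x² +
  -- y²)` times the `boost`-derivative of `Q`, which fixes the factor.
  have hM : SmoothFlat fun p => (-(1 / 2) : ℝ) • circleMean r p := hr.circleMean.const_smul _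
  obtain ⟨Q, hQ, hQz, -, hQb⟩ := exists_boost_primitive hM
    (fun p hp => by rw [circleMean_eq_zero_of_mem_axisCone hrz hp, smul_zero]) (fun p => by
      have hd : fderiv ℝ (fun p => (-(1 / 2) : ℝ) • circleMean r p) p = _ :=
        ((hr.circleMean.hasFDerivAt p).const_smul (-(1 / 2) : ℝ)).fderiv
      rw [hd]
      change (-(1 / 2) : ℝ) * fderiv ℝ (circleMean r) p (rotGen p) = 0
      rw [fderiv_circleMean_rotGen hr.1, mul_zero])
  have hβ₃ : SmoothFlat fun p => Q p • dθ p := hQ.smul_dθ hQz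
  refine ⟨fun p => β₁ p + β₂ p + Q p • dθ p, (hβ₁.add hβ₂).add hβ₃, fun p => ?_⟩
  refine eq_zero_of_off_axis (continuous_leafwiseCurl ((hβ₁.add hβ₂).add hβ₃)) hh.1.continuous
    (fun p hp => ?_) p
  rw [leafwiseCurl_add (hβ₁.add hβ₂) hβ₃, leafwiseCurl_add hβ₁ hβ₂, hcurl₂,
    leafwiseCurl_smul_dθ hQ.differentiable hp, hQb, hr_def, smul_eq_mul]
  field_simp
  ring

end Decomposition

/-! ### Translation between differential forms and functions or covector fields. -/

noncomputable section Forms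

/-- The `0`-form given by a function. -/
def zeroForm (g : R3 → ℝ) : Form 0 := fun p =>
  ContinuousAlternatingMap.constOfIsEmpty ℝ R3 (Fin 0) (g p)

theorem oneForm_apply (φ : R3 →L[ℝ] ℝ) (v : Fin 1 → R3) : oneForm φ v = φ (v 0) := rfl

theorem zeroForm_mem_flatForms {g : R3 → ℝ} (hg : SmoothFlat g) : zeroForm g ∈ flatForms 0 :=
  hg.clm_comp ((ContinuousAlternatingMap.constOfIsEmptyLIE ℝ R3 ℝ (Fin 0)).toContinuousLinearEquiv :
    ℝ →L[ℝ] R3 [⋀^Fin 0]→L[ℝ] ℝ)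

theorem exists_zeroForm_eq {α : Form 0} (hα : α ∈ flatForms 0) :
    ∃ g, SmoothFlat g ∧ α = zeroForm g := by
  let e := ContinuousAlternatingMap.constOfIsEmptyLIE ℝ R3 ℝ (Fin 0)
  refine ⟨fun p => e.symm (α p), SmoothFlat.clm_comp hα
    (e.symm.toContinuousLinearEquiv : (R3 [⋀^Fin 0]→L[ℝ] ℝ) →L[ℝ] ℝ), funext fun p => ?_⟩
  exact (e.apply_symm_apply (α p)).symm

/-- Covectors are alternating forms of degree one. -/
def oneFormEquiv : (R3 →L[ℝ] ℝ) ≃ₗᵢ[ℝ] (R3 [⋀^Fin 1]→L[ℝ] ℝ) :=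
  ContinuousAlternatingMap.ofSubsingletonLIE (0 : Fin 1)

theorem oneForm_mem_flatForms {β : R3 → R3 →L[ℝ] ℝ} (hβ : SmoothFlat β) :
    (fun p => oneForm (β p)) ∈ flatForms 1 :=
  hβ.clm_comp (oneFormEquiv.toContinuousLinearEquiv : (R3 →L[ℝ] ℝ) →L[ℝ] R3 [⋀^Fin 1]→L[ℝ] ℝ)

theorem exists_oneForm_eq {α : Form 1} (hα : α ∈ flatForms 1) :
    ∃ β : R3 → R3 →L[ℝ] ℝ, SmoothFlat β ∧ α = fun p => oneForm (β p) := by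
  refine ⟨fun p => oneFormEquiv.symm (α p), SmoothFlat.clm_comp hα
    (oneFormEquiv.symm.toContinuousLinearEquiv : (R3 [⋀^Fin 1]→L[ℝ] ℝ) →L[ℝ] R3 →L[ℝ] ℝ),
    funext fun p => ?_⟩
  exact (oneFormEquiv.apply_symm_apply (α p)).symm

theorem extDeriv_zeroForm (g : R3 → ℝ) :
    extDeriv (zeroForm g) = fun p => oneForm (fderiv ℝ g p) :=
  funext fun p => extDeriv_constOfIsEmpty g p

theorem extDeriv_oneForm_apply {β : R3 → R3 →L[ℝ] ℝ} (hβ : Differentiable ℝ β) (p : R3)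
    (v : Fin 2 → R3) : extDeriv (fun p => oneForm (β p)) p v =
      fderiv ℝ β p (v 0) (v 1) - fderiv ℝ β p (v 1) (v 0) := by
  have hd : DifferentiableAt ℝ (fun p => oneForm (β p)) p :=
    (oneFormEquiv.toContinuousLinearEquiv.differentiableAt).comp p (hβ p)
  rw [extDeriv_apply hd, Fin.sum_univ_two]
  have h : ∀ w : R3, fderiv ℝ (fun p => β p w) p = (fderiv ℝ β p).flip w := fun w => by
    rw [((hβ p).hasFDerivAt.clm_apply (hasFDerivAt_const w p)).fderiv]
    ext u
    simp
  simp only [oneForm_apply, h]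
  simp [Fin.removeNth_apply, sub_eq_add_neg]

theorem wedge_zeroForm (φ : R3 →L[ℝ] ℝ) (g : R3 → ℝ) (p : R3) :
    wedge φ (zeroForm g p) = g p • oneForm φ := by
  ext v
  rw [wedge_apply]
  simp [zeroForm, oneForm_apply, mul_comm]

theorem wedge_oneForm_apply (φ ψ : R3 →L[ℝ] ℝ) (v : Fin 2 → R3) :
    wedge φ (oneForm ψ) v = φ (v 0) * ψ (v 1) - φ (v 1) * ψ (v 0) := by
  rw [wedge_apply, Fin.sum_univ_two]
  have h0 : (0 : Fin 2).removeNth v 0 = v 1 := rfl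
  have h1 : (1 : Fin 2).removeNth v 0 = v 0 := rfl
  rw [oneForm_apply, oneForm_apply, h0, h1]
  simp [sub_eq_add_neg]

/-- The vector `φ(v₀) v₁ - φ(v₁) v₀` lies in the kernel of `φ`, and `φ ∧ ψ` evaluated on `(v₀, v₁)`
is `ψ` of that vector. So `df ∧ β` depends only on `β` along the leaves. -/
theorem wedge_oneForm_eq {φ ψ χ : R3 →L[ℝ] ℝ} (h : ∀ u, φ u = 0 → ψ u = χ u) :
    wedge φ (oneForm ψ) = wedge φ (oneForm χ) := by
  ext v
  have := h (φ (v 0) • v 1 - φ (v 1) • v 0) (by simp; ring)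
  simpa [wedge_oneForm_apply] using this

/-- Evaluation on a transverse vector and `u` recovers the leafwise values wherever `df ≠ 0`. -/
theorem eq_of_wedge_oneForm_eq {p : R3} (hp : p ≠ 0) {ψ χ : R3 →L[ℝ] ℝ}
    (h : wedge (df p) (oneForm ψ) = wedge (df p) (oneForm χ)) {u : R3} (hu : df p u = 0) :
    ψ u = χ u := by
  obtain ⟨n, hn⟩ := exists_df_ne_zero hp
  have := congrArg (fun α => α ![n, u]) h
  simpa [wedge_oneForm_apply, hu, hn] using this

theorem wedge_twoForm_apply (φ : R3 →L[ℝ] ℝ) (α : R3 [⋀^Fin 2]→L[ℝ] ℝ) (u v w : R3) :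
    wedge φ α ![u, v, w] = φ u * α ![v, w] - φ v * α ![u, w] + φ w * α ![u, v] := by
  rw [wedge_apply, Fin.sum_univ_three]
  have h0 : (0 : Fin 3).removeNth ![u, v, w] = ![v, w] := by
    ext1 i; fin_cases i <;> rfl
  have h1 : (1 : Fin 3).removeNth ![u, v, w] = ![u, w] := by
    ext1 i; fin_cases i <;> rfl
  have h2 : (2 : Fin 3).removeNth ![u, v, w] = ![u, v] := by
    ext1 i; fin_cases i <;> rfl
  rw [h0, h1, h2]
  simp
  ring

theorem threeForm_ext {α γ : R3 [⋀^Fin 3]→L[ℝ] ℝ}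
    (h : α ![basisVec 0, basisVec 1, basisVec 2] = γ ![basisVec 0, basisVec 1, basisVec 2]) :
    α = γ := by
  let e := (EuclideanSpace.basisFun (Fin 3) ℝ).toBasis
  have he : (e : Fin 3 → R3) = ![basisVec 0, basisVec 1, basisVec 2] := by
    ext1 i
    fin_cases i <;> simp [e]
  refine ContinuousAlternatingMap.toAlternatingMap_injective ?_
  rw [α.toAlternatingMap.eq_smul_basis_det e, γ.toAlternatingMap.eq_smul_basis_det e, he]
  congr 1

theorem form_eq_zero {n : ℕ} (hn : 3 < n) (α : R3 [⋀^Fin n]→L[ℝ] ℝ) : α = 0 := by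
  ext v
  refine α.toAlternatingMap.map_linearDependent v fun h => ?_
  have := h.fintype_card_le_finrank
  simp at this
  omega

theorem dfWedge_extDeriv_oneForm_apply {β : R3 → R3 →L[ℝ] ℝ} (hβ : SmoothFlat β) (p : R3) :
    dfWedge 2 (extDeriv fun p => oneForm (β p)) p ![basisVec 0, basisVec 1, basisVec 2] =
      leafwiseCurl β p := by
  change wedge (df p) _ _ = _
  rw [wedge_twoForm_apply]
  simp only [extDeriv_oneForm_apply hβ.differentiable]
  simp [leafwiseCurl]
  ring

/-- Evaluation on one transverse and two tangent vectors leaves only the antisymmetrized derivative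
of `β` on the tangent pair. -/
theorem leafwiseClosed_of_dfWedge_eq_zero {β : R3 → R3 →L[ℝ] ℝ} (hβ : SmoothFlat β)
    (h : dfWedge 2 (extDeriv fun p => oneForm (β p)) = 0) : LeafwiseClosed β := by
  intro p u v hu hv
  by_cases hp : p = 0
  · rw [hp, hβ.fderiv.apply_zero]
    rfl
  obtain ⟨n, hn⟩ := exists_df_ne_zero hp
  have h1 : wedge (df p) (extDeriv (fun p => oneForm (β p)) p) ![n, u, v] = 0 := by
    have := congrFun h p
    change wedge (df p) (extDeriv (fun p => oneForm (β p)) p) = 0 at this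
    rw [this]
    rfl
  rw [wedge_twoForm_apply, hu, hv, extDeriv_oneForm_apply hβ.differentiable] at h1
  simpa [hn, sub_eq_zero] using h1

theorem smoothFlat_dfWedge {n : ℕ} {α : Form n} (hα : α ∈ flatForms n) :
    SmoothFlat (dfWedge n α) := by
  have hdf : ContDiff ℝ ∞ df := contDiff_f.fderiv_right (by simp)
  exact SmoothFlat.clm_comp (F := R3 →L[ℝ] R3 [⋀^Fin n]→L[ℝ] ℝ) (G := R3 [⋀^Fin (n + 1)]→L[ℝ] ℝ)
    (SmoothFlat.smooth_bilin (ContinuousLinearMap.smulRightL ℝ R3 (R3 [⋀^Fin n]→L[ℝ] ℝ)) hdf hα)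
    (ContinuousAlternatingMap.alternatizeUncurryFinCLM ℝ R3 ℝ (n := n))

/-- The cocycle `df ∧ α`. -/
def cocycleOf {k : ℕ} {α : Form k} (hα : α ∈ flatForms k) (h : dfWedge (k + 1) (extDeriv α) = 0) :
    cocycles k :=
  ⟨⟨dfWedge k α, α, hα, rfl⟩, Subtype.ext ((extDeriv_dfWedge hα.1).trans (by rw [h, neg_zero]; rfl))⟩

theorem exists_eq_cocycleOf {k : ℕ} (z : cocycles k) :
    ∃ (α : Form k) (hα : α ∈ flatForms k) (h : dfWedge (k + 1) (extDeriv α) = 0),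
      z = cocycleOf hα h := by
  obtain ⟨⟨_, α, hα, rfl⟩, hz⟩ := z
  have h1 : extDeriv (dfWedge k α) = 0 := congrArg Subtype.val hz
  rw [extDeriv_dfWedge hα.1, neg_eq_zero] at h1
  exact ⟨α, hα, h1, rfl⟩

theorem dfWedge_extDeriv_zeroForm_eq_zero_iff {g : R3 → ℝ} (hg : SmoothFlat g) :
    dfWedge 1 (extDeriv (zeroForm g)) = 0 ↔ IsCasimir g := by
  rw [extDeriv_zeroForm]
  have h0 : ∀ p, wedge (df p) (oneForm 0) = 0 := fun p => by
    ext v; simp [wedge_oneForm_apply]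
  constructor
  · refine fun h => isCasimir_of_fderiv_eq_zero hg.1 fun p hp u hu => ?_
    have h1 : wedge (df p) (oneForm (fderiv ℝ g p)) = wedge (df p) (oneForm 0) := by
      rw [h0]; exact congrFun h p
    exact eq_of_wedge_oneForm_eq (axis_ne_zero hp) h1 hu
  · intro h
    funext p
    change wedge (df p) (oneForm (fderiv ℝ g p)) = 0
    rw [← h0 p]
    refine wedge_oneForm_eq fun u hu => ?_
    by_cases hp : p = 0
    · rw [hp, hg.fderiv.apply_zero]
    · exact h.fderiv_eq_zero hp hu

theorem rep0_eq (χ : R3 → ℝ) : rep0 χ = dfWedge 0 (zeroForm χ) :=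
  funext fun p => (wedge_zeroForm (df p) χ p).symm

theorem wedge_smul (c : ℝ) (φ ψ : R3 →L[ℝ] ℝ) :
    wedge φ (oneForm (c • ψ)) = c • wedge φ (oneForm ψ) := by
  ext v
  simp [wedge_oneForm_apply]
  ring

theorem rep1_eq (η : R3 → ℝ) : rep1 η = dfWedge 1 fun p => oneForm (η p • dθ p) :=
  funext fun p => (wedge_smul (η p) (df p) (dθ p)).symm

theorem represents_of_eq {k : ℕ} {α : Form k} (hα : α ∈ flatForms k)
    (h : dfWedge (k + 1) (extDeriv α) = 0) {γ : Form (k + 1)} (hγ : γ = dfWedge k α) :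
    Represents γ (Submodule.Quotient.mk (cocycleOf hα h) : H k) :=
  ⟨cocycleOf hα h, hγ.symm, rfl⟩

/-! ### The cohomology, degree by degree. -/

theorem rep0_injective {χ χ' : R3 → ℝ} (hχ : χ ∈ CFlat) (hχ' : χ' ∈ CFlat)
    (h : rep0 χ = rep0 χ') : χ = χ' := by
  funext p
  by_cases hp : p = 0
  · have h1 : SmoothFlat χ := ⟨hχ.1.1, hχ.2⟩
    have h2 : SmoothFlat χ' := ⟨hχ'.1.1, hχ'.2⟩
    rw [hp, h1.apply_zero, h2.apply_zero]
  · obtain ⟨n, hn⟩ := exists_df_ne_zero hp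
    have h1 : χ p * df p n = χ' p * df p n :=
      congrArg (fun α : R3 [⋀^Fin 1]→L[ℝ] ℝ => α fun _ => n) (congrFun h p)
    exact mul_right_cancel₀ hn h1

theorem exists_unique_rep0 (c : H 0) : ∃! χ : R3 → ℝ, χ ∈ CFlat ∧ Represents (rep0 χ) c := by
  obtain ⟨z, rfl⟩ := Submodule.Quotient.mk_surjective _ c
  obtain ⟨α, hα, h, rfl⟩ := exists_eq_cocycleOf z
  obtain ⟨χ, hχ, rfl⟩ := exists_zeroForm_eq hα
  have hχC : χ ∈ CFlat := ⟨(dfWedge_extDeriv_zeroForm_eq_zero_iff hχ).1 h, hχ.2⟩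
  refine ⟨χ, ⟨hχC, represents_of_eq hα h (rep0_eq χ)⟩, ?_⟩
  rintro χ' ⟨hχ', z', hz', hz⟩
  refine rep0_injective hχ' hχC ?_
  have h1 : (z' - cocycleOf hα h).1 = 0 := (Submodule.Quotient.eq _).1 hz
  have h2 : z'.1 = (cocycleOf hα h).1 := sub_eq_zero.1 h1
  rw [← hz', h2, rep0_eq]
  rfl

theorem smul_dθ_of_mem_COut {η : R3 → ℝ} (hη : η ∈ COut) : SmoothFlat fun p => η p • dθ p :=
  (smoothFlat_of_mem_COut hη).smul_dθ fun _ hp => eq_zero_of_mem_COut hη (f_neg_of_mem_axisCone hp)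

theorem dfWedge_extDeriv_smul_dθ {η : R3 → ℝ} (hη : η ∈ COut) :
    dfWedge 2 (extDeriv fun p => oneForm (η p • dθ p)) = 0 := by
  have hs := smul_dθ_of_mem_COut hη
  funext p
  refine threeForm_ext ?_
  rw [dfWedge_extDeriv_oneForm_apply hs]
  change leafwiseCurl _ p = (0 : ℝ)
  refine eq_zero_of_off_axis (continuous_leafwiseCurl hs) continuous_const (fun p hp => ?_) p
  rw [leafwiseCurl_smul_dθ (smoothFlat_of_mem_COut hη).differentiable hp,
    hη.1.fderiv_eq_zero (axis_ne_zero hp) (df_boost p), mul_zero]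

theorem continuous_dfWedge_oneForm {β : R3 → R3 →L[ℝ] ℝ} (hβ : SmoothFlat β) :
    Continuous (dfWedge 1 fun p => oneForm (β p)) :=
  (smoothFlat_dfWedge (oneForm_mem_flatForms hβ)).1.continuous

theorem exists_unique_rep1 (c : H 1) : ∃! η : R3 → ℝ, η ∈ COut ∧ Represents (rep1 η) c := by
  obtain ⟨z, rfl⟩ := Submodule.Quotient.mk_surjective _ c
  obtain ⟨α, hα, h, rfl⟩ := exists_eq_cocycleOf z
  obtain ⟨β, hβ, rfl⟩ := exists_oneForm_eq hα
  obtain ⟨η, hη, g, hg, hdec⟩ := exists_leafwise_decomposition hβ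
    (leafwiseClosed_of_dfWedge_eq_zero hβ h)
  have hs := smul_dθ_of_mem_COut hη
  refine ⟨η, ⟨hη, cocycleOf (oneForm_mem_flatForms hs) (dfWedge_extDeriv_smul_dθ hη),
    (rep1_eq η).symm, ?_⟩, ?_⟩
  · refine (Submodule.Quotient.eq _).2 ?_
    -- Since `d(g df) = -df ∧ dg`, this coboundary equals `η df ∧ dθ - df ∧ β`. The decomposition is
    -- only available off the axis; continuity extends it.
    refine ⟨⟨dfWedge 0 (zeroForm g), _, zeroForm_mem_flatForms hg, rfl⟩, Subtype.ext ?_⟩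
    change extDeriv (dfWedge 0 (zeroForm g)) = dfWedge 1 (fun p => oneForm (η p • dθ p)) -
      dfWedge 1 fun p => oneForm (β p)
    rw [extDeriv_dfWedge (zeroForm_mem_flatForms hg).1, extDeriv_zeroForm, neg_eq_iff_eq_neg,
      neg_sub]
    funext p
    refine eq_zero_of_off_axis (continuous_dfWedge_oneForm hg.fderiv)
      ((continuous_dfWedge_oneForm hβ).sub (continuous_dfWedge_oneForm hs)) (fun p hp => ?_) p
    have h1 : wedge (df p) (oneForm (β p)) =
        wedge (df p) (oneForm (fderiv ℝ g p + η p • dθ p)) :=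
      wedge_oneForm_eq fun u hu => hdec p hp u hu
    change wedge (df p) (oneForm (fderiv ℝ g p)) =
      wedge (df p) (oneForm (β p)) - wedge (df p) (oneForm (η p • dθ p))
    rw [h1]
    ext v
    simp [wedge_oneForm_apply]
    ring
  · rintro η' ⟨hη', z', hz', hz⟩
    obtain ⟨⟨_, γ, hγ, rfl⟩, hdiff⟩ := (Submodule.Quotient.eq _).1 hz
    obtain ⟨g', hg', rfl⟩ := exists_zeroForm_eq hγ
    have hdiff : extDeriv (dfWedge 0 (zeroForm g')) = z'.1.1 - dfWedge 1 fun p => oneForm (β p) :=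
      congrArg Subtype.val hdiff
    rw [hz', rep1_eq, extDeriv_dfWedge hγ.1, extDeriv_zeroForm] at hdiff
    have hsub : IsCasimir fun p => η' p - η p := by
      refine isCasimir_of_fderiv_eq_zero (hη'.1.1.sub hη.1.1) fun p hp u hu => ?_
      have : fderiv ℝ (fun p => η' p - η p) p = _ :=
        (((smoothFlat_of_mem_COut hη').hasFDerivAt p).sub
          ((smoothFlat_of_mem_COut hη).hasFDerivAt p)).fderiv
      rw [this]
      change fderiv ℝ η' p u - fderiv ℝ η p u = 0
      rw [hη'.1.fderiv_eq_zero (axis_ne_zero hp) hu, hη.1.fderiv_eq_zero (axis_ne_zero hp) hu,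
        sub_zero]
    -- Two representatives of the class give `(η' - η) dθ = d(g - g')` along the leaves, so the
    -- period argument forces `η' = η`.
    have hG : SmoothFlat fun p => g p - g' p := hg.sub hg'
    funext p
    refine sub_eq_zero.1 (eq_zero_of_leafwise_exact hsub hG.1 (fun p hp u hu => ?_) p)
    have hp0 := axis_ne_zero hp
    have h1 : wedge (df p) (oneForm (β p - fderiv ℝ g' p)) =
        wedge (df p) (oneForm (η' p • dθ p)) := by
      have := congrFun hdiff p
      change -wedge (df p) (oneForm (fderiv ℝ g' p)) =
        wedge (df p) (oneForm (η' p • dθ p)) - wedge (df p) (oneForm (β p)) at this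
      have h2 : wedge (df p) (oneForm (β p - fderiv ℝ g' p)) =
          wedge (df p) (oneForm (β p)) + -wedge (df p) (oneForm (fderiv ℝ g' p)) := by
        ext v
        simp [wedge_oneForm_apply]
        ring
      rw [h2, this]
      abel
    have h2 : β p u - fderiv ℝ g' p u = η' p * dθ p u := eq_of_wedge_oneForm_eq hp0 h1 hu
    have h3 := hdec p hp u hu
    have hd : fderiv ℝ (fun p => g p - g' p) p = _ :=
      ((hg.hasFDerivAt p).sub (hg'.hasFDerivAt p)).fderiv
    rw [hd]
    change _ = fderiv ℝ g p u - fderiv ℝ g' p u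
    linear_combination h3 - h2

theorem subsingleton_H_two : Subsingleton (H 2) := by
  refine subsingleton_of_forall_eq 0 fun c => ?_
  obtain ⟨z, rfl⟩ := Submodule.Quotient.mk_surjective _ c
  obtain ⟨α, hα, h, rfl⟩ := exists_eq_cocycleOf z
  -- The minus sign anticipates `d(df ∧ β) = -df ∧ dβ`.
  have hh : SmoothFlat fun p => -dfWedge 2 α p ![basisVec 0, basisVec 1, basisVec 2] :=
    ((smoothFlat_dfWedge hα).clm_comp (ContinuousAlternatingMap.apply ℝ R3 ℝ
      ![basisVec 0, basisVec 1, basisVec 2])).neg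
  obtain ⟨β, hβ, hcurl⟩ := exists_leafwiseCurl_eq hh
  refine (Submodule.Quotient.mk_eq_zero _).2 ?_
  refine ⟨⟨dfWedge 1 fun p => oneForm (β p), _, oneForm_mem_flatForms hβ, rfl⟩, Subtype.ext ?_⟩
  change extDeriv (dfWedge 1 fun p => oneForm (β p)) = dfWedge 2 α
  rw [extDeriv_dfWedge (oneForm_mem_flatForms hβ).1]
  funext p
  refine threeForm_ext ?_
  change -(dfWedge 2 (extDeriv fun p => oneForm (β p)) p ![basisVec 0, basisVec 1, basisVec 2]) = _
  rw [dfWedge_extDeriv_oneForm_apply hβ, hcurl, neg_neg]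

theorem subsingleton_H {k : ℕ} (hk : 2 ≤ k) : Subsingleton (H k) := by
  rcases hk.eq_or_lt with rfl | hk
  · exact subsingleton_H_two
  refine subsingleton_of_forall_eq 0 fun c => ?_
  obtain ⟨z, rfl⟩ := Submodule.Quotient.mk_surjective _ c
  have : z = 0 := Subtype.ext (Subtype.ext (funext fun p => form_eq_zero (by omega) _))
  rw [this]
  rfl

end Forms

end FlatFoliated

theorem theorem4p2 :
    ((∀ χ ∈ FlatFoliated.CFlat,
        ∃ c : FlatFoliated.H 0, FlatFoliated.Represents (FlatFoliated.rep0 χ) c) ∧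
      ∀ c : FlatFoliated.H 0,
        ∃! χ : FlatFoliated.R3 → ℝ,
          χ ∈ FlatFoliated.CFlat ∧ FlatFoliated.Represents (FlatFoliated.rep0 χ) c) ∧
    ((∀ η ∈ FlatFoliated.COut,
        ∃ c : FlatFoliated.H 1, FlatFoliated.Represents (FlatFoliated.rep1 η) c) ∧
      ∀ c : FlatFoliated.H 1,
        ∃! η : FlatFoliated.R3 → ℝ,
          η ∈ FlatFoliated.COut ∧ FlatFoliated.Represents (FlatFoliated.rep1 η) c) ∧
    ∀ k : ℕ, 2 ≤ k → Subsingleton (FlatFoliated.H k) := by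
  refine ⟨⟨fun χ hχ => ?_, FlatFoliated.exists_unique_rep0⟩, ⟨fun η hη => ?_,
    FlatFoliated.exists_unique_rep1⟩, fun k hk => FlatFoliated.subsingleton_H hk⟩
  · have h : FlatFoliated.SmoothFlat χ := ⟨hχ.1.1, hχ.2⟩
    exact ⟨_, FlatFoliated.represents_of_eq (FlatFoliated.zeroForm_mem_flatForms h)
      ((FlatFoliated.dfWedge_extDeriv_zeroForm_eq_zero_iff h).2 hχ.1) (FlatFoliated.rep0_eq χ)⟩
  · exact ⟨_, FlatFoliated.represents_of_eq
      (FlatFoliated.oneForm_mem_flatForms (FlatFoliated.smul_dθ_of_mem_COut hη))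
      (FlatFoliated.dfWedge_extDeriv_smul_dθ hη) (FlatFoliated.rep1_eq η)⟩
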